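/- Let $k$ be a non-archimedean local field of characteristic different from $2$ with ring of integers $R$. A lattice is a finitely generated $R$-submodule $L$ of a regular (finite-dimensional) quadratic space $(V,Q)$ over $k$ with $kL=V$; its rank is $\dim_k V$. Two lattices are isometric if some isometry between their quadratic spaces maps one onto the other. Put $\langle v,w\rangle=Q(v+w)-Q(v)-Q(w)$ and $L^\vee=\{v\in V:\langle v,w\rangle\in R\text{ for all }w\in L\}$. The lattice $L$ is called special if $Q(L)\subseteq R$, its rank is odd, and the $R$-module $L^\vee/L$ is cyclic. The determinant of $L$ is $\det L=(-1)^{\lfloor m/2\rfloor}\det(\langle v_i,v_j\rangle)$ for a basis $v_1,\dots,v_m$ of the free $R$-module $L$; it is well defined up to squares of units of $R$, and $L$ has determinant $d$ if $\det L=d$ for some basis. The Eichler invariant $e(L)$ of a special lattice $L$ of determinant $2N$ is $1$ if $4N\,Q(v)=1$ for some $v\in L^\vee$, and $-1$ otherwise. Theorem. Let $n\ge 1$ be an integer, let $N\in R$ with $N\neq 0$, and let $e\in\{\pm1\}$, with $e=1$ if $N\in R^\times$. Then there is exactly one isometry class of special lattices of rank $2n+1$, determinant $2N$ and Eichler invariant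 $e$: such a lattice exists, and any two of them are isometric. -/

import Mathlib

open scoped ValuativeRel

universe u v w

namespace QuadraticLattice

variable {R : Type*} {k : Type*} {V : Type*} {W : Type*}
variable [CommRing R] [Field k] [Algebra R k]
variable [AddCommGroup V] [Module R V] [Module k V] [IsScalarTower R k V]
variable [AddCommGroup W] [Module R W] [Module k W] [IsScalarTower R k W]

/-- The dual lattice `L^∨ = {v | ⟨v, w⟩ ∈ R for all w ∈ L}`, where
`⟨v, w⟩ = Q (v + w) - Q v - Q w`. -/
def dual (Q : QuadraticForm k V) (L : Submodule R V) : Submodule R V :=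
  LinearMap.BilinForm.dualSubmodule Q.polarBilin L

/-- `L` is integral: `Q(L) ⊆ R`. -/
def IsIntegral (Q : QuadraticForm k V) (L : Submodule R V) : Prop :=
  ∀ x ∈ L, Q x ∈ Set.range (algebraMap R k)

/-- `L` is a special lattice on the quadratic space `(V, Q)`: the space is regular, `L` is a
lattice on `V` (finitely generated over `R`, spanning `V` over `k`), it is integral, of odd rank,
and `L^∨ / L` is a cyclic `R`-module. -/
structure IsSpecial (Q : QuadraticForm k V) (L : Submodule R V) : Prop where
  regular : Q.polarBilin.Nondegenerate
  isLattice : L.IsLattice k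
  integral : IsIntegral Q L
  odd_rank : Odd (Module.finrank k V)
  cyclic : (⊤ : Submodule R (dual Q L ⧸ L.submoduleOf (dual Q L))).IsPrincipal

/-- The signed determinant `(-1)^⌊m/2⌋ det ⟨b i, b j⟩` computed in a basis `b` of `L`. -/
noncomputable def signedDet (Q : QuadraticForm k V) {L : Submodule R V} {m : ℕ}
    (b : Module.Basis (Fin m) R L) : k :=
  (-1) ^ (m / 2) * (Matrix.of fun i j => Q.polarBilin (b i : V) (b j : V)).det

/-- The free lattice `L` has determinant `d`. The determinant of `L` is only defined up to squares
of units of `R`, and replacing one basis vector by a unit multiple of it realizes every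
representative, so this says that `d` is the signed determinant in some basis. -/
def HasDet (Q : QuadraticForm k V) (L : Submodule R V) (d : k) : Prop :=
  ∃ (m : ℕ) (b : Module.Basis (Fin m) R L), signedDet Q b = d

open Classical in
/-- The Eichler invariant of a lattice `L` of determinant `2 N`: it is `1` if `4 N Q(x) = 1` for
some `x ∈ L^∨`, and `-1` otherwise. (It does not change if `N` is multiplied by the square of a
unit.) -/
noncomputable def eichlerInvariant (Q : QuadraticForm k V) (L : Submodule R V) (N : R) : ℤˣ :=
  if ∃ x ∈ dual Q L, 4 * algebraMap R k N * Q x = 1 then 1 else -1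

/-- `L` is a special lattice of rank `r`, determinant `2 N` and Eichler invariant `e`. -/
def IsSpecialOfType (Q : QuadraticForm k V) (L : Submodule R V) (r : ℕ) (N : R) (e : ℤˣ) : Prop :=
  IsSpecial Q L ∧ Module.finrank k V = r ∧ HasDet Q L (2 * algebraMap R k N) ∧
    eichlerInvariant Q L N = e

/-- The lattices `L` on `(V, Q)` and `M` on `(W, P)` are isometric: some isometry of the quadratic
spaces `V ≃ W` maps `L` onto `M`. -/
def Isometric (Q : QuadraticForm k V) (L : Submodule R V)
    (P : QuadraticForm k W) (M : Submodule R W) : Prop :=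
  ∃ σ : Q.IsometryEquiv P, ∀ x : V, σ x ∈ M ↔ x ∈ L

end QuadraticLattice

/-! Cyclicity of `L^∨ / L` says that, modulo the maximal ideal, the polar form has a radical of
dimension at most one. So L is almost unimodular, and can be split by lifting from the finite
residue field.

By Chevalley–Warning a form in at least three variables is isotropic modulo the maximal ideal. In
rank at least four the zero can be taken in the kernel of a functional generating the cokernel of L
→ L^*; there it is automatically nonsingular, so Hensel's lemma lifts it and a hyperbolic plane
splits off. In rank three a plane of unit discriminant still splits off, either hyperbolic or
anisotropic modulo the maximal ideal. All planes of the second kind are isometric to x² + xy + cy²,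
for a fixed c such that t² + t + c has no root in the residue field
(`IsAnisotropicPair.exists_pair`). Hence L is a sum of hyperbolic planes, one plane x² + xy + εy²
with ε ∈ {0, c}, and a line az². If a is a unit, the anisotropic plane together with the line is
isotropic, and ε = 0 can be arranged (`HasCyclicDiscriminant.equivalent_modelForm`).

The determinant gives a(1 - 4ε) = N once a unit square is absorbed into a. The Eichler invariant is
1 exactly when ε = 0 (`isSpecialOfType_modelLattice`). Thus N and e determine ε and a, which is
uniqueness, and the model with these parameters gives existence; e = -1 needs a, equivalently N, to
be a nonunit.

Residue characteristic two is not treated apart over R: binary forms are kept in the shape x² + xy +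
cy², with discriminant 1 - 4c, and squares are never completed there. -/

namespace QuadraticLattice

open IsLocalRing

/-! ### Quadratic equations over a finite field -/

section ResidueField

variable {F : Type*} [Field F] [Finite F]

/-- A quadratic form in at least three variables over a finite field is isotropic. -/
theorem exists_ne_zero_sum_mul_eq_zero {ι : Type*} [Fintype ι] (hι : 3 ≤ Fintype.card ι)
    (A : ι → ι → F) : ∃ x : ι → F, x ≠ 0 ∧ ∑ i, ∑ j, x i * x j * A i j = 0 := by
  classical
  have := Fintype.ofFinite F
  obtain ⟨p, hp⟩ := CharP.exists F
  have hp2 := CharP.char_ne_one F p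
  let f : MvPolynomial ι F := ∑ i, ∑ j, MvPolynomial.X i * MvPolynomial.X j * MvPolynomial.C (A i j)
  have heval (x : ι → F) : MvPolynomial.eval x f = ∑ i, ∑ j, x i * x j * A i j := by
    simp [f]
  have hdeg : f.totalDegree ≤ 2 := by
    refine MvPolynomial.totalDegree_finsetSum_le fun i _ =>
      MvPolynomial.totalDegree_finsetSum_le fun j _ => ?_
    refine (MvPolynomial.totalDegree_mul _ _).trans ?_
    rw [MvPolynomial.totalDegree_C, add_zero]
    refine (MvPolynomial.totalDegree_mul _ _).trans ?_
    simp
  -- Chevalley–Warning: the degree is less than the number of variables, so p divides the number of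
  -- zeros, and the trivial zero cannot be the only one.
  have hdvd := char_dvd_card_solutions p (f := f) (by omega)
  have hne : Fintype.card {x // MvPolynomial.eval x f = 0} ≠ 1 := by
    intro h
    rw [h] at hdvd
    exact hp2 (Nat.dvd_one.mp hdvd)
  have h0 : MvPolynomial.eval 0 f = 0 := by rw [heval]; simp
  have : Nontrivial {x // MvPolynomial.eval x f = 0} := by
    have : Nonempty {x // MvPolynomial.eval x f = 0} := ⟨⟨0, h0⟩⟩
    rw [← Fintype.one_lt_card_iff_nontrivial]
    have := Fintype.card_pos (α := {x // MvPolynomial.eval x f = 0})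
    omega
  obtain ⟨⟨x, hx⟩, hx0⟩ := exists_ne (⟨0, h0⟩ : {x // MvPolynomial.eval x f = 0})
  exact ⟨x, fun h => hx0 (Subtype.ext h), by rw [← heval, hx]⟩

/-- Some polynomial `t² + t + c` over a finite field has no root. -/
theorem exists_forall_sq_add_self_add_ne_zero : ∃ c : F, ∀ t : F, t ^ 2 + t + c ≠ 0 := by
  -- The map takes the same value at 0 and -1; on a finite set it therefore misses some value c.
  have hinj : ¬ Function.Injective fun t : F => -(t ^ 2 + t) := fun h => by
    have := @h 0 (-1) (by simp)
    simp at this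
  rw [Finite.injective_iff_surjective] at hinj
  simp only [Function.Surjective, not_forall, not_exists] at hinj
  obtain ⟨c, hc⟩ := hinj
  exact ⟨c, fun t ht => hc t (by linear_combination -ht)⟩

/-- If neither `t² + t + c` nor `t² + t + d` has a root in a finite field, then their discriminants
differ by a square, in the form that makes sense in characteristic two as well. -/
theorem exists_mul_sq_add_self_add_eq_zero {c d : F} (hc : ∀ t : F, t ^ 2 + t + c ≠ 0)
    (hd : ∀ t : F, t ^ 2 + t + d ≠ 0) :
    ∃ s : F, (1 - 4 * d) * (s ^ 2 + s) + (c - d) = 0 := by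
  classical
  have := Fintype.ofFinite F
  by_cases h2 : (2 : F) = 0
  · have h4 : (4 : F) = 0 := by linear_combination 2 * h2
    -- Artin–Schreier: in characteristic two t² + t is additive with kernel {0, 1}, so its image has
    -- index two and contains the sum of two elements outside it.
    let φ : F →+ F :=
      { toFun := fun t => t ^ 2 + t
        map_zero' := by simp
        map_add' := fun x y => by linear_combination x * y * h2 }
    have hker (t : F) : t ∈ φ.ker ↔ t = 0 ∨ t = 1 := by
      have : t ^ 2 + t = t * (t - 1) + 2 * t := by ring
      rw [AddMonoidHom.mem_ker]
      change t ^ 2 + t = 0 ↔ _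
      rw [this, h2, zero_mul, add_zero, mul_eq_zero, sub_eq_zero]
    have hcard : Nat.card φ.ker = 2 := by
      have : (φ.ker : Set F) = {0, 1} := by
        ext t
        simpa using hker t
      rw [← SetLike.coe_sort_coe, this, Nat.card_coe_set_eq, Set.ncard_pair zero_ne_one]
    have hindex : φ.range.index = 2 := by
      have h1 := φ.ker.card_mul_index
      have h2 := φ.range.card_mul_index
      rw [AddSubgroup.index_ker, hcard, mul_comm] at h1
      have h3 : Nat.card φ.range ≠ 0 := Nat.card_pos.ne'
      exact Nat.eq_of_mul_eq_mul_left (Nat.pos_of_ne_zero h3) (h2.trans h1.symm)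
    have hneg (x : F) : -x = x := by linear_combination -x * h2
    have hmem {x : F} (h : ∀ t : F, t ^ 2 + t + x ≠ 0) : x ∉ φ.range := by
      rintro ⟨t, ht⟩
      refine h t ?_
      rw [← ht]
      change t ^ 2 + t + (t ^ 2 + t) = 0
      linear_combination (t ^ 2 + t) * h2
    obtain ⟨s, hs⟩ := (AddSubgroup.add_mem_iff_of_index_two hindex (a := c) (b := d)).2
      (iff_of_false (hmem hc) (hmem hd))
    change s ^ 2 + s = c + d at hs
    exact ⟨s, by linear_combination hs + (c - 2 * d * (s ^ 2 + s)) * h2⟩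
  -- When 2 is invertible, having no root means having nonsquare discriminant, and a product of two
  -- nonsquares is a square.
  · have hsq {x : F} (h : ∀ t : F, t ^ 2 + t + x ≠ 0) : ¬ IsSquare (1 - 4 * x) := by
      rintro ⟨r, hr⟩
      refine h ((r - 1) / 2) ?_
      field_simp
      linear_combination -hr
    have h1 := quadraticChar_neg_one_iff_not_isSquare.2 (hsq hc)
    have h2' := quadraticChar_neg_one_iff_not_isSquare.2 (hsq hd)
    have hd0 : 1 - 4 * d ≠ 0 := fun h => hsq hd (h ▸ IsSquare.zero)
    have hc0 : 1 - 4 * c ≠ 0 := fun h => hsq hc (h ▸ IsSquare.zero)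
    have h3 : quadraticChar F ((1 - 4 * c) * (1 - 4 * d)) = 1 := by rw [map_mul, h1, h2']; norm_num
    obtain ⟨r, hr⟩ := (quadraticChar_one_iff_isSquare (mul_ne_zero hc0 hd0)).1 h3
    refine ⟨(r / (1 - 4 * d) - 1) / 2, ?_⟩
    field_simp
    linear_combination -hr

end ResidueField

/-! ### Identities for the polar form -/

section PolarForm

variable {R M : Type*} [CommRing R] [AddCommGroup M] [Module R M]

theorem map_smul_add_smul (q : QuadraticForm R M) (r s : R) (x y : M) :
    q (r • x + s • y) = r ^ 2 * q x + r * s * q.polarBilin x y + s ^ 2 * q y := by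
  rw [QuadraticMap.map_add q, QuadraticMap.map_smul, QuadraticMap.map_smul,
    QuadraticMap.polar_smul_left, QuadraticMap.polar_smul_right]
  simp only [smul_eq_mul, QuadraticMap.polarBilin_apply_apply]
  ring

theorem polarBilin_self (q : QuadraticForm R M) (x : M) : q.polarBilin x x = 2 * q x := by
  simp

theorem polarBilin_comm (q : QuadraticForm R M) (x y : M) :
    q.polarBilin x y = q.polarBilin y x := by
  simp [QuadraticMap.polar_comm q x y]

end PolarForm

/-! ### Hensel's lemma and lifting of nonsingular vectors -/

section Henselian

variable {R : Type*} [CommRing R] [HenselianLocalRing R]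

theorem residue_eq_zero_iff_not_isUnit {x : R} : residue R x = 0 ↔ ¬ IsUnit x := by
  rw [← residue_ne_zero_iff_isUnit, not_not]

/-- Hensel's lemma for a monic quadratic polynomial. -/
theorem exists_sq_add_mul_add_eq_zero {b c t : R} (h : residue R (t ^ 2 + b * t + c) = 0)
    (h' : IsUnit (2 * t + b)) :
    ∃ s : R, s ^ 2 + b * s + c = 0 ∧ residue R s = residue R t := by
  have hmonic : (Polynomial.X ^ 2 + Polynomial.C b * Polynomial.X + Polynomial.C c).Monic := by
    monicity!
  obtain ⟨s, hs, hst⟩ := HenselianLocalRing.is_henselian _ hmonic t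
    (by rw [← residue_eq_zero_iff]; simpa using h)
    (by simpa [one_add_one_eq_two] using h')
  refine ⟨s, by simpa [Polynomial.IsRoot] using hs, ?_⟩
  rw [← residue_eq_zero_iff, map_sub, sub_eq_zero] at hst
  exact hst

/-- Hensel's lemma for a quadratic polynomial with unit linear term, at the root zero. -/
theorem exists_mul_sq_add_mul_add_eq_zero {a b c : R} (hb : IsUnit b) (hc : residue R c = 0) :
    ∃ t : R, a * t ^ 2 + b * t + c = 0 ∧ residue R t = 0 := by
  -- The leading coefficient a need not be a unit. The monic equation s² + bs + ac = 0 has a unit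
  -- root near -b, and t = c/s is the small root of the original one.
  obtain ⟨s, hs, hsb⟩ := exists_sq_add_mul_add_eq_zero (b := b) (c := a * c) (t := -b)
    (by simp [hc, sq]) (by convert hb.neg using 1; ring)
  have hsu : IsUnit s := by
    rw [← residue_ne_zero_iff_isUnit, hsb, residue_ne_zero_iff_isUnit]
    exact hb.neg
  obtain ⟨s, rfl⟩ := hsu
  refine ⟨c * ↑s⁻¹, ?_, by simp [hc]⟩
  have hinv : (s : R) * ↑s⁻¹ = 1 := s.mul_inv
  linear_combination c * (↑s⁻¹ : R) ^ 2 * hs - c * ((s : R) * ↑s⁻¹ + 1 + b * ↑s⁻¹) * hinv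

variable {M : Type*} [AddCommGroup M] [Module R M]

/-- A value taken modulo the maximal ideal at a nonsingular vector is taken. -/
theorem exists_map_add_smul_eq (q : QuadraticForm R M) {v w : M} {d : R}
    (hv : residue R (q v) = residue R d) (hvw : IsUnit (q.polarBilin v w)) :
    ∃ t : R, q (v + t • w) = d ∧ residue R t = 0 := by
  obtain ⟨t, ht, ht0⟩ := exists_mul_sq_add_mul_add_eq_zero (a := q w) (c := q v - d) hvw
    (by rw [map_sub, hv, sub_self])
  refine ⟨t, ?_, ht0⟩
  have := map_smul_add_smul q 1 t v w
  rw [one_smul] at this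
  rw [this]
  linear_combination ht

/-- A nonsingular isotropic vector modulo the maximal ideal gives rise to a hyperbolic plane,
written in a basis in which the form is `x² + xy`. -/
theorem exists_hyperbolic_pair (q : QuadraticForm R M) {v w : M}
    (hv : residue R (q v) = 0) (hvw : IsUnit (q.polarBilin v w)) :
    ∃ e f : M, q e = 1 ∧ q.polarBilin e f = 1 ∧ q f = 0 := by
  obtain ⟨t, ht, ht0⟩ := exists_map_add_smul_eq q (d := 0) (by rw [hv, map_zero]) hvw
  set f := v + t • w
  have hfw : IsUnit (q.polarBilin f w) := by
    have : q.polarBilin f w = q.polarBilin v w + t * (2 * q w) := by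
      rw [← polarBilin_self]
      simp only [f, map_add, LinearMap.add_apply, map_smul, LinearMap.smul_apply, smul_eq_mul]
    rw [← residue_ne_zero_iff_isUnit] at hvw ⊢
    rwa [this, map_add, map_mul, ht0, zero_mul, add_zero]
  obtain ⟨β, hβ⟩ := hfw
  have hβ' : (β : R) * ↑β⁻¹ = 1 := β.mul_inv
  -- The vector w/β pairs to 1 with f; adding a multiple of the isotropic f keeps this and adjusts
  -- the value of q to 1.
  refine ⟨(1 - q w * ↑β⁻¹ ^ 2) • f + (↑β⁻¹ : R) • w, f, ?_, ?_, ht⟩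
  · rw [map_smul_add_smul, ht, ← hβ]
    linear_combination (1 - q w * ↑β⁻¹ ^ 2) * hβ'
  · rw [polarBilin_comm, map_add, map_smul, map_smul, polarBilin_self, ht, ← hβ]
    simp

end Henselian

/-! ### Model forms, splitting off planes, cyclic discriminant -/

section Forms

variable {R : Type*} [CommRing R]

/-- The binary quadratic form `x² + xy + c y²`. -/
def binaryForm (c : R) : QuadraticForm R (R × R) :=
  QuadraticMap.sq.comp (LinearMap.fst R R R) +
    QuadraticMap.linMulLin (LinearMap.fst R R R) (LinearMap.snd R R R) +
    c • QuadraticMap.sq.comp (LinearMap.snd R R R)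

@[simp]
theorem binaryForm_apply (c : R) (x : R × R) :
    binaryForm c x = x.1 ^ 2 + x.1 * x.2 + c * x.2 ^ 2 := by
  simp [binaryForm, sq]

/-- The quadratic form `a z² + ∑ (xᵢ² + xᵢ yᵢ + cᵢ yᵢ²)` in `2 n + 1` variables, where the last
`cᵢ` is `ε` and the others vanish. -/
def modelForm (n : ℕ) (ε a : R) : QuadraticForm R ((Fin n → R × R) × R) :=
  (QuadraticMap.pi fun i : Fin n => binaryForm (if (i : ℕ) + 1 = n then ε else 0)).prod
    (a • QuadraticMap.sq)

theorem modelForm_apply (n : ℕ) (ε a : R) (x : (Fin n → R × R) × R) :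
    modelForm n ε a x =
      ∑ i : Fin n, binaryForm (if (i : ℕ) + 1 = n then ε else 0) (x.1 i) + a * x.2 ^ 2 := by
  simp [modelForm, QuadraticMap.pi_apply, sq]

theorem binaryForm_prod_equivalent_modelForm_one (ε a : R) :
    ((binaryForm ε).prod (a • (QuadraticMap.sq : QuadraticForm R R))).Equivalent
      (modelForm 1 ε a) :=
  ⟨{ toLinearEquiv :=
      (LinearEquiv.funUnique (Fin 1) R (R × R)).symm.prodCongr (LinearEquiv.refl R R)
     map_app' := fun x => by simp [modelForm_apply, sq] }⟩

/-- The hyperbolic plane is put in front, so the plane carrying ε stays last. For n = 0 the new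
plane would itself be the last one. -/
theorem binaryForm_prod_equivalent_modelForm_succ {n : ℕ} (hn : 1 ≤ n) (ε a : R) :
    ((binaryForm 0).prod (modelForm n ε a)).Equivalent (modelForm (n + 1) ε a) :=
  ⟨{ toLinearEquiv := (LinearEquiv.prodAssoc R (R × R) (Fin n → R × R) R).symm.trans
      ((Fin.consLinearEquiv R fun _ : Fin (n + 1) => R × R).prodCongr (LinearEquiv.refl R R))
     map_app' := fun x => by
      have hn0 : n ≠ 0 := by omega
      change modelForm (n + 1) ε a (Fin.cons x.1 x.2.1, x.2.2) = _
      simp [modelForm_apply, Fin.sum_univ_succ, hn0.symm]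
      ring }⟩

variable {M M' : Type*} [AddCommGroup M] [Module R M] [AddCommGroup M'] [Module R M']

/-- A pair of vectors on which the form is `x² + xy + c y²` with unit discriminant splits off. -/
theorem exists_equivalent_binaryForm_prod (q : QuadraticForm R M) {e f : M} {c : R}
    (he : q e = 1) (hef : q.polarBilin e f = 1) (hf : q f = c) (hc : IsUnit (1 - 4 * c)) :
    ∃ N : Submodule R M, ((binaryForm c).prod (q.restrict N)).Equivalent q := by
  let N : Submodule R M := (q.polarBilin e).ker ⊓ (q.polarBilin f).ker
  let ψ : ((R × R) × N) →ₗ[R] M :=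
    ((LinearMap.toSpanSingleton R M e).coprod (LinearMap.toSpanSingleton R M f)).coprod N.subtype
  have hψ (r s : R) (x : N) : ψ ((r, s), x) = r • e + s • f + x := rfl
  have hN (x : N) : q.polarBilin e x = 0 ∧ q.polarBilin f x = 0 := x.2
  have hee : q.polarBilin e e = 2 := by rw [polarBilin_self, he, mul_one]
  have hff : q.polarBilin f f = 2 * c := by rw [polarBilin_self, hf]
  have hfe : q.polarBilin f e = 1 := by rw [polarBilin_comm, hef]
  have hψe (r s : R) (x : N) : q.polarBilin e (ψ ((r, s), x)) = 2 * r + s := by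
    rw [hψ, map_add, map_add, map_smul, map_smul, hee, hef, (hN x).1]
    simp only [smul_eq_mul]; ring
  have hψf (r s : R) (x : N) : q.polarBilin f (ψ ((r, s), x)) = r + 2 * c * s := by
    rw [hψ, map_add, map_add, map_smul, map_smul, hfe, hff, (hN x).2]
    simp only [smul_eq_mul]; ring
  obtain ⟨d, hd⟩ := hc
  have hd' : (d : R) * ↑d⁻¹ = 1 := d.mul_inv
  rw [hd] at hd'
  have hinj : Function.Injective ψ := by
    rw [← LinearMap.ker_eq_bot, LinearMap.ker_eq_bot']
    rintro ⟨⟨r, s⟩, x⟩ h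
    have h1 := hψe r s x
    have h2 := hψf r s x
    rw [h, map_zero] at h1 h2
    have hs : s = 0 := by linear_combination (-s) * hd' - ↑d⁻¹ * h1 + 2 * ↑d⁻¹ * h2
    have hr : r = 0 := by rw [hs] at h2; linear_combination -h2
    rw [hψ, hr, hs] at h
    have hx : x = 0 := by ext; simpa using h
    rw [hr, hs, hx]; rfl
  have hsurj : Function.Surjective ψ := by
    intro m
    set α := q.polarBilin e m with hα
    set β := q.polarBilin f m with hβ
    -- Cramer's rule for the Gram matrix of e, f, whose determinant is -(1 - 4c): this gives the
    -- orthogonal projection of m to their span.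
    set r := ↑d⁻¹ * (β - 2 * c * α) with hr
    set s := ↑d⁻¹ * (α - 2 * β) with hs
    refine ⟨((r, s), ⟨m - (r • e + s • f), ?_, ?_⟩), ?_⟩
    · rw [SetLike.mem_coe, LinearMap.mem_ker, map_sub, map_add, map_smul, map_smul, hee, hef, ← hα,
        hr, hs]
      simp only [smul_eq_mul]
      linear_combination -α * hd'
    · rw [SetLike.mem_coe, LinearMap.mem_ker, map_sub, map_add, map_smul, map_smul, hfe, hff, ← hβ,
        hr, hs]
      simp only [smul_eq_mul]
      linear_combination -β * hd'
    · rw [hψ]; simp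
  refine ⟨N, ⟨{ toLinearEquiv := LinearEquiv.ofBijective ψ ⟨hinj, hsurj⟩, map_app' := ?_ }⟩⟩
  rintro ⟨⟨r, s⟩, x⟩
  change q (ψ ((r, s), x)) = _
  have h1 := map_smul_add_smul q 1 1 (r • e + s • f) x
  simp only [one_smul, map_smul_add_smul, he, hf, hef] at h1
  rw [hψ, h1, map_add, map_smul, map_smul, LinearMap.add_apply, LinearMap.smul_apply,
    LinearMap.smul_apply, (hN x).1, (hN x).2]
  simp [QuadraticMap.restrict]
  ring

/-- The cokernel of the map from a quadratic module to its dual is cyclic. -/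
def HasCyclicDiscriminant (q : QuadraticForm R M) : Prop :=
  ∃ f₀ : Module.Dual R M, ∀ f : Module.Dual R M, ∃ (r : R) (x : M),
    ∀ y, f y = r * f₀ y + q.polarBilin x y

theorem polarBilin_isometryEquiv {q : QuadraticForm R M} {q' : QuadraticForm R M'}
    (φ : q.IsometryEquiv q') (x y : M) :
    q'.polarBilin (φ x) (φ y) = q.polarBilin x y := by
  simp only [QuadraticMap.polarBilin_apply_apply, QuadraticMap.polar, ← map_add,
    QuadraticMap.IsometryEquiv.map_app]

theorem HasCyclicDiscriminant.of_equivalent {q : QuadraticForm R M} {q' : QuadraticForm R M'}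
    (h : HasCyclicDiscriminant q) (hq : q.Equivalent q') : HasCyclicDiscriminant q' := by
  obtain ⟨f₀, h⟩ := h
  obtain ⟨φ⟩ := hq
  refine ⟨f₀ ∘ₗ φ.symm.toLinearEquiv.toLinearMap, fun f => ?_⟩
  obtain ⟨r, x, hx⟩ := h (f ∘ₗ φ.toLinearEquiv.toLinearMap)
  refine ⟨r, φ x, fun y => ?_⟩
  obtain ⟨y, rfl⟩ : ∃ z, y = φ z := ⟨φ.symm y, (φ.toLinearEquiv.apply_symm_apply y).symm⟩
  rw [polarBilin_isometryEquiv]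
  have h1 : f (φ y) = _ := hx y
  have h2 : φ.symm.toLinearEquiv (φ y) = y := φ.toLinearEquiv.symm_apply_apply y
  rw [h1, LinearMap.comp_apply]
  change _ = r * f₀ (φ.symm.toLinearEquiv (φ y)) + _
  rw [h2]

/-- A functional on the second summand, extended by zero, is handled on the whole sum and then
restricted back. This feeds the induction on rank. -/
theorem HasCyclicDiscriminant.of_prod {q : QuadraticForm R M} {q' : QuadraticForm R M'}
    (h : HasCyclicDiscriminant (q.prod q')) : HasCyclicDiscriminant q' := by
  obtain ⟨f₀, h⟩ := h
  refine ⟨f₀ ∘ₗ LinearMap.inr R M M', fun f => ?_⟩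
  obtain ⟨r, x, hx⟩ := h (f ∘ₗ LinearMap.snd R M M')
  refine ⟨r, x.2, fun y => ?_⟩
  have := hx (0, y)
  simpa using this

end Forms

/-! ### Isotropy modulo the maximal ideal and anisotropic planes -/

section FiniteResidueField

variable {R : Type*} [CommRing R] [HenselianLocalRing R]
variable {M : Type*} [AddCommGroup M] [Module R M]

/-- If the discriminant vanished in the residue field, 2 would be a unit and -1/2 a double root
there. -/
theorem isUnit_one_sub_four_mul {c : R} (hc : ∀ t : R, IsUnit (t ^ 2 + t + c)) :
    IsUnit (1 - 4 * c) := by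
  by_contra h
  rw [← residue_eq_zero_iff_not_isUnit, map_sub, map_one, map_mul, sub_eq_zero] at h
  have h2 : IsUnit (2 : R) := by
    rw [← residue_ne_zero_iff_isUnit]
    intro h2
    have h4 : (4 : R) = 2 * 2 := by norm_num
    rw [h4, map_mul, h2, zero_mul, zero_mul] at h
    exact one_ne_zero h
  obtain ⟨u, hu⟩ := h2
  have h1 := (residue_ne_zero_iff_isUnit _).2 ((u.isUnit.pow 2).mul (hc (-↑u⁻¹)))
  have h3 : (u : R) ^ 2 * ((-↑u⁻¹) ^ 2 + -↑u⁻¹ + c) = 4 * c - 1 := by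
    have hu' : (u : R) * ↑u⁻¹ = 1 := u.mul_inv
    rw [hu] at hu' ⊢
    linear_combination (2 * ↑u⁻¹ - 1) * hu'
  rw [h3, map_sub, map_one, map_mul, ← h, sub_self] at h1
  exact h1 rfl

/-- A quadratic form of rank at least three is isotropic modulo the maximal ideal. -/
theorem exists_primitive_residue_eq_zero [Finite (ResidueField R)] [Module.Free R M]
    [Module.Finite R M] (hM : 3 ≤ Module.finrank R M) (q : QuadraticForm R M) :
    ∃ (v : M) (f : Module.Dual R M), residue R (q v) = 0 ∧ IsUnit (f v) := by
  classical
  -- B need not be symmetric, so no division by 2 is required.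
  obtain ⟨B, rfl⟩ := LinearMap.BilinMap.toQuadraticMap_surjective q
  let b := Module.finBasis R M
  obtain ⟨x, hx, hsum⟩ := exists_ne_zero_sum_mul_eq_zero (by simpa using hM)
    fun i j => residue R (B (b i) (b j))
  obtain ⟨i, hi⟩ := Function.ne_iff.1 hx
  choose y hy using fun i => residue_surjective (R := R) (x i)
  refine ⟨∑ i, y i • b i, b.coord i, ?_, ?_⟩
  · simp only [LinearMap.BilinMap.toQuadraticMap_apply, map_sum, map_smul, LinearMap.sum_apply,
      LinearMap.smul_apply, smul_eq_mul, map_mul, hy]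
    rw [← hsum, Finset.sum_comm]
    simp only [Finset.mul_sum]
    refine Finset.sum_congr rfl fun i _ => Finset.sum_congr rfl fun j _ => ?_
    ring
  · rw [← residue_ne_zero_iff_isUnit, Module.Basis.coord_apply, Module.Basis.repr_sum_self, hy]
    exact hi

theorem exists_residue_ternary_eq_zero [Finite (ResidueField R)] (α β γ δ : R) :
    ∃ x y z : R, residue R (α * x ^ 2 + β * x * y + γ * y ^ 2 + δ * z ^ 2) = 0 ∧
      (residue R x ≠ 0 ∨ residue R y ≠ 0 ∨ residue R z ≠ 0) := by
  let q : QuadraticForm R (R × R × R) :=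
    α • QuadraticMap.sq.comp (LinearMap.fst R R (R × R)) +
    β • QuadraticMap.linMulLin (LinearMap.fst R R (R × R))
      (LinearMap.fst R R R ∘ₗ LinearMap.snd R R (R × R)) +
    γ • QuadraticMap.sq.comp (LinearMap.fst R R R ∘ₗ LinearMap.snd R R (R × R)) +
    δ • QuadraticMap.sq.comp (LinearMap.snd R R R ∘ₗ LinearMap.snd R R (R × R))
  obtain ⟨⟨x, y, z⟩, f, hv, hf⟩ := exists_primitive_residue_eq_zero (by simp) q
  refine ⟨x, y, z, ?_, ?_⟩
  · rw [← hv]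
    congr 1
    simp [q]
    ring
  · by_contra! h
    have hsum : ((x, y, z) : R × R × R) = x • (1, 0, 0) + y • (0, 1, 0) + z • (0, 0, 1) := by
      simp
    rw [← residue_ne_zero_iff_isUnit, hsum] at hf
    simp only [map_add, map_smul, smul_eq_mul, map_mul, h.1, h.2.1, h.2.2] at hf
    simp at hf

/-- A vector of a binary form of unit discriminant that is nonzero modulo the maximal ideal is
nonsingular. -/
theorem exists_isUnit_polarBilin (q : QuadraticForm R M) {e f : M} {x y : R}
    (hD : IsUnit (q.polarBilin e f ^ 2 - 4 * q e * q f))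
    (hxy : residue R x ≠ 0 ∨ residue R y ≠ 0) :
    IsUnit (q.polarBilin (x • e + y • f) e) ∨ IsUnit (q.polarBilin (x • e + y • f) f) := by
  simp only [← residue_ne_zero_iff_isUnit] at hD ⊢
  by_contra! h
  obtain ⟨h1, h2⟩ := h
  simp only [map_add, map_smul, LinearMap.add_apply, LinearMap.smul_apply, smul_eq_mul,
    polarBilin_self, polarBilin_comm q f e, map_mul] at h1 h2
  rw [map_sub, map_pow, map_mul, map_mul] at hD
  have h4 : residue R 4 = residue R 2 * residue R 2 := by rw [← map_mul]; norm_num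
  rw [h4] at hD
  rcases hxy with h | h
  · refine h ((mul_eq_zero.1 ?_).resolve_left hD)
    linear_combination residue R (q.polarBilin e f) * h2 - residue R 2 * residue R (q f) * h1
  · refine h ((mul_eq_zero.1 ?_).resolve_left hD)
    linear_combination residue R (q.polarBilin e f) * h1 - residue R 2 * residue R (q e) * h2

/-- The pair `e`, `f` spans a plane that is anisotropic modulo the maximal ideal. -/
def IsAnisotropicPair (q : QuadraticForm R M) (e f : M) : Prop :=
  ∀ x y : R, residue R (q (x • e + y • f)) = 0 → residue R x = 0 ∧ residue R y = 0

/-- The ternary form q - z² has a nontrivial zero modulo the maximal ideal, and anisotropy forces z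
≠ 0 there. Dividing by z represents 1 modulo the maximal ideal; unit discriminant makes the vector
nonsingular, so the value lifts. -/
theorem IsAnisotropicPair.exists_map_eq_one [Finite (ResidueField R)]
    {q : QuadraticForm R M} {e f : M}
    (h : IsAnisotropicPair q e f) (hD : IsUnit (q.polarBilin e f ^ 2 - 4 * q e * q f)) :
    ∃ x y : R, q (x • e + y • f) = 1 := by
  obtain ⟨x, y, z, h0, hxyz⟩ := exists_residue_ternary_eq_zero (q e) (q.polarBilin e f) (q f) (-1)
  have hz : residue R z ≠ 0 := by
    intro hz
    have : residue R (q (x • e + y • f)) = 0 := by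
      rw [map_smul_add_smul, ← h0]
      simp only [map_add, map_mul, map_pow, hz]
      ring
    have := h x y this
    tauto
  rw [residue_ne_zero_iff_isUnit] at hz
  obtain ⟨z, rfl⟩ := hz
  set x' := ↑z⁻¹ * x
  set y' := ↑z⁻¹ * y
  have hz' : (z : R) * ↑z⁻¹ = 1 := z.mul_inv
  have h1 : residue R (q (x' • e + y' • f)) = residue R 1 := by
    rw [← sub_eq_zero, ← map_sub, map_smul_add_smul]
    have : x' ^ 2 * q e + x' * y' * q.polarBilin e f + y' ^ 2 * q f - 1 =
        ↑z⁻¹ ^ 2 *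
          (q e * x ^ 2 + q.polarBilin e f * x * y + q f * y ^ 2 + -1 * (z : R) ^ 2) := by
      linear_combination (z * ↑z⁻¹ + 1) * hz'
    rw [this, map_mul, h0, mul_zero]
  have hxy : residue R x' ≠ 0 ∨ residue R y' ≠ 0 := by
    by_contra! h'
    rw [map_smul_add_smul] at h1
    simp [h'.1, h'.2] at h1
  rcases exists_isUnit_polarBilin q hD hxy with hu | hu
  · obtain ⟨t, ht, -⟩ := exists_map_add_smul_eq q h1 hu
    exact ⟨x' + t, y', by rw [← ht]; congr 1; module⟩
  · obtain ⟨t, ht, -⟩ := exists_map_add_smul_eq q h1 hu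
    exact ⟨x', y' + t, by rw [← ht]; congr 1; module⟩

/-- A vector of value 1 is primitive, hence completes to a basis of the plane by a matrix of
determinant 1. Such a change of basis preserves both anisotropy and the discriminant. -/
theorem IsAnisotropicPair.exists_pair_map_eq_one [Finite (ResidueField R)]
    {q : QuadraticForm R M} {e f : M}
    (h : IsAnisotropicPair q e f) (hD : IsUnit (q.polarBilin e f ^ 2 - 4 * q e * q f)) :
    ∃ e' f' : M, IsAnisotropicPair q e' f' ∧ q e' = 1 ∧
      IsUnit (q.polarBilin e' f' ^ 2 - 4 * q f') := by
  obtain ⟨x, y, hxy⟩ := h.exists_map_eq_one hD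
  obtain ⟨x', y', hdet⟩ : ∃ x' y' : R, x * y' - x' * y = 1 := by
    have : residue R x ≠ 0 ∨ residue R y ≠ 0 := by
      by_contra! h'
      have := congrArg (residue R) hxy
      rw [map_smul_add_smul] at this
      simp [h'.1, h'.2] at this
    simp only [residue_ne_zero_iff_isUnit] at this
    rcases this with ⟨u, rfl⟩ | ⟨u, rfl⟩
    · exact ⟨0, ↑u⁻¹, by simp⟩
    · exact ⟨-↑u⁻¹, 0, by simp⟩
  refine ⟨x • e + y • f, x' • e + y' • f, fun s t hst => ?_, hxy, ?_⟩
  · have : s • (x • e + y • f) + t • (x' • e + y' • f) =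
        (s * x + t * x') • e + (s * y + t * y') • f := by module
    rw [this] at hst
    obtain ⟨h1, h2⟩ := h _ _ hst
    constructor
    · have : s = y' * (s * x + t * x') - x' * (s * y + t * y') := by
        linear_combination (-s) * hdet
      rw [this, map_sub, map_mul, map_mul, h1, h2, mul_zero, mul_zero, sub_zero]
    · have : t = x * (s * y + t * y') - y * (s * x + t * x') := by
        linear_combination (-t) * hdet
      rw [this, map_sub, map_mul, map_mul, h1, h2, mul_zero, mul_zero, sub_zero]
  · convert hD using 1
    have hB : q.polarBilin (x • e + y • f) (x' • e + y' • f) =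
        2 * x * x' * q e + (x * y' + x' * y) * q.polarBilin e f + 2 * y * y' * q f := by
      simp only [map_add, map_smul, LinearMap.add_apply, LinearMap.smul_apply, smul_eq_mul,
        polarBilin_self, polarBilin_comm q f e]
      ring
    rw [map_smul_add_smul] at hxy
    rw [hB, map_smul_add_smul]
    linear_combination (q.polarBilin e f ^ 2 - 4 * q e * q f) * (x * y' - x' * y + 1) * hdet -
      4 * (x' ^ 2 * q e + x' * y' * q.polarBilin e f + y' ^ 2 * q f) * (-1) * hxy

/-- Any two planes of unit discriminant that are anisotropic modulo the maximal ideal are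
isometric. -/
theorem IsAnisotropicPair.exists_pair [Finite (ResidueField R)]
    {q : QuadraticForm R M} {e f : M} {c : R}
    (h : IsAnisotropicPair q e f) (hD : IsUnit (q.polarBilin e f ^ 2 - 4 * q e * q f))
    (hc : ∀ t : R, IsUnit (t ^ 2 + t + c)) :
    ∃ e' f' : M, q e' = 1 ∧ q.polarBilin e' f' = 1 ∧ q f' = c := by
  obtain ⟨e, f, h, he, hD⟩ := h.exists_pair_map_eq_one hD
  -- If the polar value is not a unit, unit discriminant makes 2 a unit. In either case f can be
  -- replaced by a vector pairing to 1 with e.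
  obtain ⟨s, u, hsu⟩ : ∃ (s : R) (u : Rˣ), 2 * s + u * q.polarBilin e f = 1 := by
    by_cases hu : IsUnit (q.polarBilin e f)
    · obtain ⟨u, hu⟩ := hu
      exact ⟨0, u⁻¹, by rw [← hu]; simp⟩
    · have h2 : IsUnit (2 : R) := by
        rw [← residue_ne_zero_iff_isUnit] at hD ⊢
        rw [← residue_eq_zero_iff_not_isUnit] at hu
        intro h2
        apply hD
        have : (4 : R) = 2 * 2 := by norm_num
        rw [map_sub, map_pow, hu, this, map_mul, map_mul, h2]
        simp
      obtain ⟨u, hu⟩ := h2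
      exact ⟨↑u⁻¹ * (1 - q.polarBilin e f), 1, by rw [← hu]; simp⟩
  set f₁ := s • e + (u : R) • f
  have hef : q.polarBilin e f₁ = 1 := by
    rw [map_add, map_smul, map_smul, polarBilin_self, he]
    simp only [smul_eq_mul]
    linear_combination hsu
  set d := q f₁ with hd
  have hdu (t : R) : IsUnit (t ^ 2 + t + d) := by
    rw [← residue_ne_zero_iff_isUnit]
    intro h0
    have := (h (t + s) u (by
      rw [← h0]
      have h1 : (t + s) • e + (u : R) • f = t • e + (1 : R) • f₁ := by module
      rw [h1, map_smul_add_smul, he, hef, ← hd]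
      congr 1; ring)).2
    exact (residue_eq_zero_iff_not_isUnit.1 this) u.isUnit
  have hbar {d : R} (hd : ∀ t : R, IsUnit (t ^ 2 + t + d)) (t : ResidueField R) :
      t ^ 2 + t + residue R d ≠ 0 := by
    obtain ⟨t, rfl⟩ := residue_surjective t
    simpa using (residue_ne_zero_iff_isUnit _).2 (hd t)
  -- The discriminants 1 - 4d and 1 - 4c are to differ by a unit square. A root t of t² + t + κ with
  -- κ = (d - c)/(1 - 4c), lifted from the residue field, satisfies (2t + 1)² = (1 - 4d)/(1 - 4c),
  -- and (te + f₁)/(2t + 1) is the second vector sought.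
  obtain ⟨r, hr⟩ := exists_mul_sq_add_self_add_eq_zero (hbar hdu) (hbar hc)
  obtain ⟨r, rfl⟩ := residue_surjective r
  have hd4 : IsUnit (1 - 4 * d) := by
    have : d = s ^ 2 + s * u * q.polarBilin e f + u ^ 2 * q f := by
      rw [hd, map_smul_add_smul, he]; ring
    have : 1 - 4 * d = u ^ 2 * (q.polarBilin e f ^ 2 - 4 * q f) := by
      rw [this]
      linear_combination (-(2 * s + u * q.polarBilin e f) - 1) * hsu
    rw [this]
    exact (u.isUnit.pow 2).mul hD
  obtain ⟨Δ, hΔ⟩ := isUnit_one_sub_four_mul hc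
  have hΔ' : (Δ : R) * ↑Δ⁻¹ = 1 := Δ.mul_inv
  rw [hΔ] at hΔ'
  set κ := ↑Δ⁻¹ * (d - c) with hκ
  have hκ4 : 1 - 4 * κ = ↑Δ⁻¹ * (1 - 4 * d) := by
    rw [hκ]; linear_combination -hΔ'
  have hκu : IsUnit (1 - 4 * κ) := by rw [hκ4]; exact Δ⁻¹.isUnit.mul hd4
  have hr0 : residue R (r ^ 2 + 1 * r + κ) = 0 := by
    have : r ^ 2 + 1 * r + κ = ↑Δ⁻¹ * ((1 - 4 * c) * (r ^ 2 + r) + (d - c)) := by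
      rw [hκ]; linear_combination (-(r ^ 2 + r)) * hΔ'
    rw [this, map_mul]
    simp only [map_add, map_mul, map_sub, map_pow, map_one, map_ofNat] at hr ⊢
    rw [hr, mul_zero]
  have hr1 : IsUnit (2 * r + 1) := by
    rw [← residue_ne_zero_iff_isUnit] at hκu ⊢
    intro h0
    apply hκu
    have : 1 - 4 * κ = (2 * r + 1) * (2 * r + 1) - 4 * (r ^ 2 + 1 * r + κ) := by ring
    rw [this, map_sub, map_mul, map_mul, h0, hr0, mul_zero, mul_zero, sub_zero]
  obtain ⟨t, ht, -⟩ := exists_sq_add_mul_add_eq_zero hr0 hr1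
  have hsq : (2 * t + 1) ^ 2 = 1 - 4 * κ := by linear_combination 4 * ht
  obtain ⟨m, hm⟩ : IsUnit (2 * t + 1) := by
    rw [← isUnit_pow_iff two_ne_zero, hsq]; exact hκu
  have hm' : (m : R) * ↑m⁻¹ = 1 := m.mul_inv
  refine ⟨e, (↑m⁻¹ * t) • e + (↑m⁻¹ : R) • f₁, he, ?_, ?_⟩
  · rw [map_add, map_smul, map_smul, hef, polarBilin_self, he]
    simp only [smul_eq_mul]
    linear_combination hm' - ↑m⁻¹ * hm
  · rw [map_smul_add_smul, he, hef, ← hd]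
    have hm2 : (m : R) ^ 2 = ↑Δ⁻¹ * (1 - 4 * d) := by rw [hm, hsq, hκ4]
    have key : t ^ 2 + t + d = c * (m : R) ^ 2 := by
      rw [hm2]
      rw [hκ] at ht
      linear_combination ht - d * hΔ'
    linear_combination ↑m⁻¹ ^ 2 * key + c * (m * ↑m⁻¹ + 1) * hm'

end FiniteResidueField

/-! ### Kernels of functionals and forms of rank one -/

section RankOne

variable {R : Type*} [CommRing R] [IsDomain R]
variable {M : Type*} [AddCommGroup M] [Module R M]

/-- The image is an ideal of a principal ideal domain, hence projective, so f splits onto its image.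
The projection serves to extend functionals from the kernel to M. -/
theorem exists_projection_ker [IsPrincipalIdealRing R] (f : Module.Dual R M) :
    ∃ π : M →ₗ[R] f.ker, ∀ x : f.ker, π x = x := by
  obtain ⟨s, hs⟩ := LinearMap.exists_rightInverse_of_surjective f.rangeRestrict
    f.range_rangeRestrict
  have hs' (y : f.range) : f (s y) = y := congrArg Subtype.val (LinearMap.congr_fun hs y)
  refine ⟨LinearMap.codRestrict f.ker (LinearMap.id - s ∘ₗ f.rangeRestrict) fun x => ?_,
    fun x => ?_⟩
  · simp [LinearMap.mem_ker, hs']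
  · have : f.rangeRestrict x = 0 := Subtype.ext x.2
    ext
    simp [this]

theorem le_finrank_ker_add_one [Module.Free R M] [Module.Finite R M] (f : Module.Dual R M) :
    Module.finrank R M ≤ Module.finrank R f.ker + 1 := by
  rw [← Submodule.finrank_quotient_add_finrank f.ker, f.quotKerEquivRange.finrank_eq]
  have := Submodule.finrank_le f.range
  rw [Module.finrank_self] at this
  omega

theorem finrank_ker_add_one [Module.Free R M] [Module.Finite R M] (f : Module.Dual R M)
    (hf : Function.Surjective f) : Module.finrank R M = Module.finrank R f.ker + 1 := by
  rw [← Submodule.finrank_quotient_add_finrank f.ker,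
    (f.quotKerEquivOfSurjective hf).finrank_eq, Module.finrank_self, add_comm]

theorem exists_equivalent_smul_sq [Module.Free R M] [Module.Finite R M]
    (hM : Module.finrank R M = 1) (q : QuadraticForm R M) :
    ∃ a : R, q.Equivalent (a • (QuadraticMap.sq : QuadraticForm R R)) := by
  obtain ⟨φ⟩ := FiniteDimensional.nonempty_linearEquiv_of_finrank_eq
    (R := R) (M := M) (M' := R) (by rw [hM, Module.finrank_self])
  refine ⟨q (φ.symm 1), ⟨{ toLinearEquiv := φ, map_app' := fun x => ?_ }⟩⟩
  change q (φ.symm 1) * (φ x * φ x) = q x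
  have : x = φ x • φ.symm 1 := by
    rw [← map_smul, smul_eq_mul, mul_one, LinearEquiv.symm_apply_apply]
  conv_rhs => rw [this, QuadraticMap.map_smul, smul_eq_mul]
  ring

end RankOne

/-! ### Finding hyperbolic planes -/

section HyperbolicPair

variable {R : Type*} [CommRing R]

theorem exists_hyperbolic_pair_of_equivalent {M M' : Type*} [AddCommGroup M] [Module R M]
    [AddCommGroup M'] [Module R M'] {q : QuadraticForm R M} {q' : QuadraticForm R M'}
    (hq : q.Equivalent q') (h : ∃ e f : M, q e = 1 ∧ q.polarBilin e f = 1 ∧ q f = 0) :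
    ∃ e f : M', q' e = 1 ∧ q'.polarBilin e f = 1 ∧ q' f = 0 := by
  obtain ⟨φ⟩ := hq
  obtain ⟨e, f, he, hef, hf⟩ := h
  exact ⟨φ e, φ f, by rw [φ.map_app, he], by rw [polarBilin_isometryEquiv, hef],
    by rw [φ.map_app, hf]⟩

/-- An anisotropic plane of unit discriminant and a unit together represent zero. -/
theorem exists_hyperbolic_pair_binaryForm_prod [HenselianLocalRing R] [Finite (ResidueField R)]
    {c a : R} (hc : IsUnit (1 - 4 * c)) (ha : IsUnit a) :
    ∃ e f : (R × R) × R,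
      ((binaryForm c).prod (a • QuadraticMap.sq)) e = 1 ∧
      ((binaryForm c).prod (a • QuadraticMap.sq)).polarBilin e f = 1 ∧
      ((binaryForm c).prod (a • QuadraticMap.sq)) f = 0 := by
  obtain ⟨x, y, z, h, hxyz⟩ := exists_residue_ternary_eq_zero 1 1 c a
  set q : QuadraticForm R ((R × R) × R) := (binaryForm c).prod (a • QuadraticMap.sq) with hq
  have hqv (x y z : R) : q ((x, y), z) = 1 * x ^ 2 + 1 * x * y + c * y ^ 2 + a * z ^ 2 := by
    simp [hq]; ring
  have hpol (x y z x' y' z' : R) : q.polarBilin ((x, y), z) ((x', y'), z') =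
      2 * x * x' + x * y' + x' * y + 2 * c * y * y' + 2 * a * z * z' := by
    simp only [QuadraticMap.polarBilin_apply_apply, QuadraticMap.polar, Prod.mk_add_mk, hqv]
    ring
  -- If x and y both vanished modulo the maximal ideal, az² would vanish too, and z with it since a
  -- is a unit. So the zero is nonsingular already against the plane.
  have hxy : residue R x ≠ 0 ∨ residue R y ≠ 0 := by
    by_contra! h'
    have hz : residue R z ≠ 0 := by tauto
    simp only [map_add, map_mul, map_pow, h'.1, h'.2] at h
    simp only [ne_eq, OfNat.ofNat_ne_zero, not_false_eq_true, zero_pow, mul_zero, add_zero,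
      zero_add, mul_eq_zero, pow_eq_zero_iff] at h
    exact h.elim ((residue_ne_zero_iff_isUnit a).2 ha) hz
  have hv : residue R (q ((x, y), z)) = 0 := by rw [hqv, h]
  have hu := exists_isUnit_polarBilin q (e := ((1, 0), 0)) (f := ((0, 1), 0)) (x := x) (y := y)
    (by simpa [hpol, hqv] using hc) hxy
  rcases hu with hu | hu
  · refine exists_hyperbolic_pair q hv (w := ((1, 0), 0)) ?_
    simpa [hpol] using hu
  · refine exists_hyperbolic_pair q hv (w := ((0, 1), 0)) ?_
    simpa [hpol] using hu

end HyperbolicPair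

/-! ### Reduction to the model forms -/

section Classification

variable {R : Type*} [CommRing R] [IsDomain R] [IsPrincipalIdealRing R] [HenselianLocalRing R]
  [Finite (ResidueField R)]
variable {M : Type*} [AddCommGroup M] [Module R M] [Module.Free R M] [Module.Finite R M]

/-- A form of rank at least four with cyclic discriminant splits off a hyperbolic plane. -/
theorem HasCyclicDiscriminant.exists_hyperbolic_pair {q : QuadraticForm R M}
    (h : HasCyclicDiscriminant q) (hM : 4 ≤ Module.finrank R M) :
    ∃ e f : M, q e = 1 ∧ q.polarBilin e f = 1 ∧ q f = 0 := by
  obtain ⟨f₀, h⟩ := h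
  have := le_finrank_ker_add_one f₀
  obtain ⟨v, g, hv, hg⟩ := exists_primitive_residue_eq_zero (by omega) (q.restrict f₀.ker)
  obtain ⟨π, hπ⟩ := exists_projection_ker f₀
  -- On the kernel of f₀ every functional is a pairing with a vector of M. Applied to a functional
  -- that is a unit at v, this shows v to be nonsingular.
  obtain ⟨r, x, hx⟩ := h (g ∘ₗ π)
  have hxv := hx v
  rw [LinearMap.comp_apply, hπ, LinearMap.mem_ker.1 v.2, mul_zero, zero_add] at hxv
  rw [hxv, polarBilin_comm] at hg
  exact QuadraticLattice.exists_hyperbolic_pair q hv hg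

/-- A ternary form with cyclic discriminant splits off a plane of unit discriminant. -/
theorem HasCyclicDiscriminant.exists_pair {q : QuadraticForm R M}
    (h : HasCyclicDiscriminant q) (hM : Module.finrank R M = 3) {c : R}
    (hc : ∀ t : R, IsUnit (t ^ 2 + t + c)) :
    (∃ e f : M, q e = 1 ∧ q.polarBilin e f = 1 ∧ q f = 0) ∨
      ∃ e f : M, q e = 1 ∧ q.polarBilin e f = 1 ∧ q f = c := by
  obtain ⟨f₀, h⟩ := h
  obtain ⟨v, g, hv, hg⟩ := exists_primitive_residue_eq_zero (by omega) q
  by_cases hvw : ∃ w, IsUnit (q.polarBilin v w)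
  · obtain ⟨w, hw⟩ := hvw
    exact .inl (QuadraticLattice.exists_hyperbolic_pair q hv hw)
  push Not at hvw
  simp only [← residue_eq_zero_iff_not_isUnit] at hvw
  -- Now v lies in the radical modulo the maximal ideal, so a functional that is a unit at v must
  -- get this from f₀. Hence M is the sum of R v and the rank two kernel of f₀.
  obtain ⟨u, hu⟩ : IsUnit (f₀ v) := by
    obtain ⟨r, x, hx⟩ := h g
    rw [hx v, polarBilin_comm, ← residue_ne_zero_iff_isUnit, map_add, hvw, add_zero, map_mul] at hg
    exact (residue_ne_zero_iff_isUnit _).1 (right_ne_zero_of_mul hg)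
  have hsurj : Function.Surjective f₀ := fun r => ⟨(r * ↑u⁻¹) • v, by simp [← hu]⟩
  have hker := finrank_ker_add_one f₀ hsurj
  let b : Module.Basis (Fin 2) R f₀.ker := Module.finBasisOfFinrankEq R f₀.ker (by omega)
  obtain ⟨π, hπ⟩ := exists_projection_ker f₀
  set e : M := ((b 0 : f₀.ker) : M) with he
  set f : M := ((b 1 : f₀.ker) : M) with hf
  have hmem (x y : R) : x • e + y • f ∈ f₀.ker :=
    add_mem (Submodule.smul_mem _ _ (b 0).2) (Submodule.smul_mem _ _ (b 1).2)
  -- Otherwise some nonzero residual combination of e, f is orthogonal to the kernel plane and to v,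
  -- hence to everything. But its coordinates are pairings with vectors of M, so they would all
  -- vanish.
  have hD : IsUnit (q.polarBilin e f ^ 2 - 4 * q e * q f) := by
    by_contra hD
    rw [← residue_eq_zero_iff_not_isUnit] at hD
    obtain ⟨x, y, hxy, hxe, hxf⟩ : ∃ x y : R, (residue R x ≠ 0 ∨ residue R y ≠ 0) ∧
        residue R (2 * q e * x + q.polarBilin e f * y) = 0 ∧
        residue R (q.polarBilin e f * x + 2 * q f * y) = 0 := by
      -- A kernel vector of the singular Gram matrix: read off from its first row if that row is
      -- nonzero, and (1, 0) otherwise.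
      by_cases hb : residue R (-q.polarBilin e f) ≠ 0 ∨ residue R (2 * q e) ≠ 0
      · refine ⟨-q.polarBilin e f, 2 * q e, hb, ?_, ?_⟩
        · convert map_zero (residue R) using 2; ring
        · rw [← neg_eq_zero, ← map_neg, ← hD]; congr 1; ring
      · push Not at hb
        refine ⟨1, 0, .inl (by simp), ?_, ?_⟩
        · rw [mul_one, mul_zero, add_zero, hb.2]
        · rw [mul_one, mul_zero, add_zero, ← neg_eq_zero, ← map_neg, hb.1]
    have horth (m : M) : residue R (q.polarBilin m (x • e + y • f)) = 0 := by
      obtain ⟨t, n, rfl⟩ : ∃ (t : R) (n : f₀.ker), m = t • v + n :=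
        ⟨f₀ m * ↑u⁻¹, ⟨m - (f₀ m * ↑u⁻¹) • v, by simp [LinearMap.mem_ker, ← hu]⟩, by simp⟩
      have hn := b.sum_repr n
      rw [Fin.sum_univ_two] at hn
      rw [← hn, q.polarBilin.map_add, q.polarBilin.map_smul, LinearMap.add_apply,
        LinearMap.smul_apply, smul_eq_mul, (residue R).map_add, (residue R).map_mul, hvw, mul_zero,
        zero_add]
      simp only [Submodule.coe_add, Submodule.coe_smul, map_add, map_smul, LinearMap.add_apply,
        LinearMap.smul_apply, smul_eq_mul, ← he, ← hf, polarBilin_self, polarBilin_comm q f e,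
        map_mul] at hxe hxf ⊢
      linear_combination residue R (b.repr n 0) * hxe + residue R (b.repr n 1) * hxf
    have hcoord (i : Fin 2) : residue R (b.repr (π (x • e + y • f)) i) = 0 := by
      obtain ⟨r, z, hz⟩ := h (b.coord i ∘ₗ π)
      have := hz (x • e + y • f)
      rw [LinearMap.comp_apply, Module.Basis.coord_apply, LinearMap.mem_ker.1 (hmem x y), mul_zero,
        zero_add] at this
      rw [this, horth]
    have hπ' : π (x • e + y • f) = x • b 0 + y • b 1 := by
      rw [map_add, map_smul, map_smul, hπ, hπ]
    have h0 := hcoord 0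
    have h1 := hcoord 1
    rw [hπ'] at h0 h1
    simp at h0 h1
    simp only [residue_ne_zero_iff_isUnit] at hxy
    tauto
  by_cases han : IsAnisotropicPair q e f
  · exact .inr (han.exists_pair hD hc)
  · left
    simp only [IsAnisotropicPair, not_forall] at han
    obtain ⟨x, y, hq, hxy⟩ := han
    rcases exists_isUnit_polarBilin q hD (x := x) (y := y) (by tauto) with hu | hu <;>
      exact QuadraticLattice.exists_hyperbolic_pair q hq hu

/-- The complement of the plane split off is a line az². When the plane is anisotropic and a is a
unit, the whole form contains a hyperbolic plane, and splitting that off instead gives ε = 0. -/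
theorem HasCyclicDiscriminant.equivalent_modelForm_one {q : QuadraticForm R M}
    (h : HasCyclicDiscriminant q) (hM : Module.finrank R M = 3) {c : R}
    (hc : ∀ t : R, IsUnit (t ^ 2 + t + c)) :
    ∃ ε a : R, (ε = 0 ∨ ε = c ∧ ¬ IsUnit a) ∧ q.Equivalent (modelForm 1 ε a) := by
  have key {e f : M} {ε : R} (he : q e = 1) (hef : q.polarBilin e f = 1) (hf : q f = ε)
      (hε : IsUnit (1 - 4 * ε)) :
      ∃ a : R, ((binaryForm ε).prod (a • (QuadraticMap.sq : QuadraticForm R R))).Equivalent q := by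
    obtain ⟨N, ⟨φ⟩⟩ := exists_equivalent_binaryForm_prod q he hef hf hε
    have hN : Module.finrank R N = 1 := by
      have := φ.toLinearEquiv.finrank_eq
      rw [hM, Module.finrank_prod, Module.finrank_prod, Module.finrank_self] at this
      omega
    obtain ⟨a, ha⟩ := exists_equivalent_smul_sq hN (q.restrict N)
    exact ⟨a, (QuadraticMap.Equivalent.prod (.refl _) ha.symm).trans ⟨φ⟩⟩
  have hyp (h : ∃ e f : M, q e = 1 ∧ q.polarBilin e f = 1 ∧ q f = 0) :
      ∃ ε a : R, (ε = 0 ∨ ε = c ∧ ¬ IsUnit a) ∧ q.Equivalent (modelForm 1 ε a) := by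
    obtain ⟨e, f, he, hef, hf⟩ := h
    obtain ⟨a, ha⟩ := key he hef hf (by simp)
    exact ⟨0, a, .inl rfl, ha.symm.trans (binaryForm_prod_equivalent_modelForm_one 0 a)⟩
  rcases h.exists_pair hM hc with h | ⟨e, f, he, hef, hf⟩
  · exact hyp h
  · have hc' := isUnit_one_sub_four_mul hc
    obtain ⟨a, ha⟩ := key he hef hf hc'
    by_cases hau : IsUnit a
    · exact hyp (exists_hyperbolic_pair_of_equivalent ha
        (exists_hyperbolic_pair_binaryForm_prod hc' hau))
    · exact ⟨c, a, .inr ⟨rfl, hau⟩,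
        ha.symm.trans (binaryForm_prod_equivalent_modelForm_one c a)⟩

/-- Quadratic forms of odd rank with cyclic discriminant split off hyperbolic planes until a
ternary form with a hyperbolic plane or an unramified anisotropic plane is left. -/
theorem HasCyclicDiscriminant.equivalent_modelForm {M : Type*} [AddCommGroup M] [Module R M]
    [Module.Free R M] [Module.Finite R M] {q : QuadraticForm R M}
    (h : HasCyclicDiscriminant q) {n : ℕ} (hn : 1 ≤ n) (hM : Module.finrank R M = 2 * n + 1)
    {c : R} (hc : ∀ t : R, IsUnit (t ^ 2 + t + c)) :
    ∃ ε a : R, (ε = 0 ∨ ε = c ∧ ¬ IsUnit a) ∧ q.Equivalent (modelForm n ε a) := by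
  induction n, hn using Nat.le_induction generalizing M with
  | base => exact h.equivalent_modelForm_one hM hc
  | succ n hn ih =>
    obtain ⟨e, f, he, hef, hf⟩ := h.exists_hyperbolic_pair (by omega)
    obtain ⟨N, hN⟩ := exists_equivalent_binaryForm_prod q he hef hf (by simp)
    have hcyc : HasCyclicDiscriminant (q.restrict N) := (h.of_equivalent hN.symm).of_prod
    have hrank : Module.finrank R N = 2 * n + 1 := by
      obtain ⟨φ⟩ := hN
      have := φ.toLinearEquiv.finrank_eq
      rw [hM, Module.finrank_prod, Module.finrank_prod, Module.finrank_self] at this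
      omega
    obtain ⟨ε, a, hε, ha⟩ := ih hcyc hrank
    exact ⟨ε, a, hε, hN.symm.trans ((QuadraticMap.Equivalent.prod (.refl _) ha).trans
      (binaryForm_prod_equivalent_modelForm_succ hn ε a))⟩

end Classification

/-! ### Polar form and determinant of the model forms -/

section ModelForm

variable {R : Type*} [CommRing R]

theorem modelForm_polarBilin (n : ℕ) (ε a : R) (x y : (Fin n → R × R) × R) :
    (modelForm n ε a).polarBilin x y =
      ∑ i : Fin n, (2 * (x.1 i).1 * (y.1 i).1 + (x.1 i).1 * (y.1 i).2 + (x.1 i).2 * (y.1 i).1 +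
        2 * (if (i : ℕ) + 1 = n then ε else 0) * (x.1 i).2 * (y.1 i).2) + 2 * a * x.2 * y.2 := by
  simp only [QuadraticMap.polarBilin_apply_apply, QuadraticMap.polar, modelForm_apply,
    binaryForm_apply, Prod.fst_add, Prod.snd_add, Pi.add_apply]
  have h (s t r α β γ δ : R) (h : s - t - r = δ) :
      s + α - (t + β) - (r + γ) = δ + (α - β - γ) := by rw [← h]; ring
  rw [h _ _ _ _ _ _ _ (by rw [← Finset.sum_sub_distrib, ← Finset.sum_sub_distrib])]
  congr 1
  · exact Finset.sum_congr rfl fun i _ => by ring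
  · ring

theorem modelForm_equivalent_mul_sq (n : ℕ) (ε a : R) (u : Rˣ) :
    (modelForm n ε a).Equivalent (modelForm n ε (a * u ^ 2)) :=
  ⟨{ toLinearEquiv := (LinearEquiv.refl R (Fin n → R × R)).prodCongr
      (LinearEquiv.smulOfUnit u⁻¹)
     map_app' := fun x => by
      change modelForm n ε (a * u ^ 2) (x.1, (↑u⁻¹ : R) * x.2) = _
      have hu : (u : R) * ↑u⁻¹ = 1 := u.mul_inv
      rw [modelForm_apply, modelForm_apply]
      linear_combination a * x.2 ^ 2 * (u * ↑u⁻¹ + 1) * hu }⟩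

variable (R) in
/-- The standard basis of the module underlying `modelForm`. -/
noncomputable def modelBasis (n : ℕ) :
    Module.Basis ((Fin 2 × Fin n) ⊕ Unit) R ((Fin n → R × R) × R) :=
  ((Pi.basis fun _ : Fin n => Module.Basis.finTwoProd R).reindex
    ((Equiv.sigmaEquivProd (Fin n) (Fin 2)).trans (Equiv.prodComm _ _))).prod
    (Module.Basis.singleton Unit R)

@[simp]
theorem modelBasis_inl (n : ℕ) (j : Fin 2) (i : Fin n) :
    modelBasis R n (.inl (j, i)) = (Pi.single i (Module.Basis.finTwoProd R j), 0) := by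
  simp [modelBasis]

@[simp]
theorem modelBasis_inr (n : ℕ) (j : Unit) : modelBasis R n (.inr j) = (0, 1) := by
  simp [modelBasis]

theorem det_toMatrix_modelForm {n : ℕ} (hn : 1 ≤ n) (ε a : R) :
    (LinearMap.BilinForm.toMatrix (modelBasis R n) (modelForm n ε a).polarBilin).det =
      (-1) ^ n * (2 * (a * (1 - 4 * ε))) := by
  classical
  let c : Fin n → R := fun i => if (i : ℕ) + 1 = n then ε else 0
  have hblock : LinearMap.BilinForm.toMatrix (modelBasis R n) (modelForm n ε a).polarBilin =
      Matrix.fromBlocks (Matrix.blockDiagonal fun i => !![2, 1; 1, 2 * c i]) 0 0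
        (Matrix.of fun _ _ : Unit => 2 * a) := by
    ext i j
    rw [LinearMap.BilinForm.toMatrix_apply, modelForm_polarBilin]
    rcases i with ⟨i, i'⟩ | i <;> rcases j with ⟨j, j'⟩ | j
    · rw [Finset.sum_eq_single i']
      · by_cases hij : i' = j'
        · subst hij
          fin_cases i <;> fin_cases j <;> simp [Matrix.blockDiagonal_apply, c]
        · simp [Matrix.blockDiagonal_apply, hij]
      · intro l _ hl
        simp [Pi.single_apply, hl]
      · simp
    · simp
    · simp
    · simp
  have hprod : ∏ i : Fin n, (1 - 4 * c i) = 1 - 4 * ε := by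
    rw [Finset.prod_eq_single (⟨n - 1, by omega⟩ : Fin n)]
    · simp [c, Nat.sub_add_cancel hn]
    · intro i _ hi
      have : (i : ℕ) + 1 ≠ n := fun h => hi (Fin.ext (by simp; omega))
      simp [c, this]
    · simp
  rw [hblock, Matrix.det_fromBlocks_zero₂₁, Matrix.det_blockDiagonal, Matrix.det_unique,
    Matrix.of_apply]
  have : ∀ i : Fin n, (!![2, 1; 1, 2 * c i] : Matrix (Fin 2) (Fin 2) R).det =
      (-1) * (1 - 4 * c i) := fun i => by rw [Matrix.det_fin_two_of]; ring
  simp only [this, Finset.prod_mul_distrib, hprod, Finset.prod_const, Finset.card_univ,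
    Fintype.card_fin]
  ring

end ModelForm

/-! ### Isometries preserve the Eichler invariant -/

section Isometric

variable {R k V W : Type*} [CommRing R] [Field k]
variable [AddCommGroup V] [Module R V] [Module k V] [AddCommGroup W] [Module R W] [Module k W]

theorem Isometric.symm {Q : QuadraticForm k V} {L : Submodule R V} {P : QuadraticForm k W}
    {M : Submodule R W} (h : Isometric Q L P M) : Isometric P M Q L := by
  obtain ⟨σ, hσ⟩ := h
  refine ⟨σ.symm, fun x => ?_⟩
  rw [← hσ]
  have : σ (σ.symm x) = x := σ.toLinearEquiv.apply_symm_apply x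
  rw [this]

theorem Isometric.trans {U : Type*} [AddCommGroup U] [Module R U] [Module k U]
    {Q : QuadraticForm k V} {L : Submodule R V} {P : QuadraticForm k W}
    {M : Submodule R W} {S : QuadraticForm k U} {N : Submodule R U} (h : Isometric Q L P M)
    (h' : Isometric P M S N) : Isometric Q L S N := by
  obtain ⟨σ, hσ⟩ := h
  obtain ⟨τ, hτ⟩ := h'
  exact ⟨σ.trans τ, fun x => (hτ (σ x)).trans (hσ x)⟩

variable [Algebra R k] [IsScalarTower R k V] [IsScalarTower R k W]

theorem Isometric.exists_dual {Q : QuadraticForm k V} {L : Submodule R V}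
    {P : QuadraticForm k W} {M : Submodule R W} (h : Isometric Q L P M) {d : k}
    (hx : ∃ x ∈ dual Q L, d * Q x = 1) : ∃ x ∈ dual P M, d * P x = 1 := by
  obtain ⟨σ, hσ⟩ := h
  obtain ⟨x, hx, hN⟩ := hx
  refine ⟨σ x, fun y hy => ?_, by rw [σ.map_app, hN]⟩
  obtain ⟨y, rfl⟩ := σ.toLinearEquiv.surjective y
  have := hx y ((hσ y).1 hy)
  rwa [← polarBilin_isometryEquiv σ] at this

theorem Isometric.eichlerInvariant_eq {Q : QuadraticForm k V} {L : Submodule R V}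
    {P : QuadraticForm k W} {M : Submodule R W} (h : Isometric Q L P M) (N : R) :
    eichlerInvariant Q L N = eichlerInvariant P M N := by
  unfold eichlerInvariant
  congr 1
  exact propext ⟨h.exists_dual, h.symm.exists_dual⟩

end Isometric

/-! ### From lattices in a quadratic space to quadratic modules and back -/

section Lattice

variable {R k V W : Type*} [CommRing R] [Field k] [Algebra R k] [IsFractionRing R k]
variable [AddCommGroup V] [Module R V] [Module k V] [IsScalarTower R k V]
variable [AddCommGroup W] [Module R W] [Module k W] [IsScalarTower R k W]

/-- The quadratic form with values in `R` on an integral lattice. -/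
noncomputable def integralForm (Q : QuadraticForm k V) {L : Submodule R V} (h : IsIntegral Q L) :
    QuadraticForm R L :=
  have hspec (x : L) : algebraMap R k (h x x.2).choose = Q x := (h x x.2).choose_spec
  QuadraticMap.ofPolar (fun x => (h x x.2).choose)
    (fun a x => IsFractionRing.injective R k (by
      rw [hspec, smul_eq_mul, map_mul, map_mul, hspec, Submodule.coe_smul,
        ← algebraMap_smul k a (x : V), QuadraticMap.map_smul, smul_eq_mul]))
    (fun x x' y => IsFractionRing.injective R k (by
      simp only [QuadraticMap.polar, map_sub, map_add, hspec]
      exact QuadraticMap.polar_add_left Q (x : V) x' y))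
    (fun a x y => IsFractionRing.injective R k (by
      simp only [QuadraticMap.polar, map_sub, smul_eq_mul, map_mul, hspec]
      have := QuadraticMap.polar_smul_left Q (algebraMap R k a) (x : V) y
      rw [algebraMap_smul] at this
      exact this))

theorem algebraMap_integralForm (Q : QuadraticForm k V) {L : Submodule R V} (h : IsIntegral Q L)
    (x : L) : algebraMap R k (integralForm Q h x) = Q x :=
  (h x x.2).choose_spec

theorem algebraMap_polarBilin_integralForm (Q : QuadraticForm k V) {L : Submodule R V}
    (h : IsIntegral Q L) (x y : L) :
    algebraMap R k ((integralForm Q h).polarBilin x y) = Q.polarBilin (x : V) y := by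
  simp only [QuadraticMap.polarBilin_apply_apply, QuadraticMap.polar, map_sub,
    algebraMap_integralForm, Submodule.coe_add]

/-- Extend the functional linearly to V and represent it through the nondegenerate polar form. This
identifies the dual lattice with the dual module, turning cyclicity of `L^∨ / L` into
`HasCyclicDiscriminant`. -/
theorem exists_dual_forall_eq [IsDomain R] [IsPrincipalIdealRing R] {Q : QuadraticForm k V}
    {L : Submodule R V} [L.IsLattice k] (hQ : Q.polarBilin.Nondegenerate) (f : Module.Dual R L) :
    ∃ v ∈ dual Q L, ∀ y : L, Q.polarBilin v y = algebraMap R k (f y) := by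
  let b := Module.finBasis R L
  let b' := b.extendOfIsLattice k
  have : FiniteDimensional k V := b'.finiteDimensional_of_finite
  let F : V →ₗ[k] k := b'.constr k fun i => algebraMap R k (f (b i))
  have hF (y : L) : F y = algebraMap R k (f y) := by
    have : F.restrictScalars R ∘ₗ L.subtype = Algebra.linearMap R k ∘ₗ f := by
      refine b.ext fun i => ?_
      have := b'.constr_basis k (fun i => algebraMap R k (f (b i))) i
      rw [Module.Basis.extendOfIsLattice_apply] at this
      exact this
    exact LinearMap.congr_fun this y
  obtain ⟨v, hv⟩ := (LinearMap.BilinForm.toDual Q.polarBilin hQ).surjective F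
  have hv' (y : V) : Q.polarBilin v y = F y := by
    rw [← hv, LinearMap.BilinForm.toDual_def]
  refine ⟨v, fun y hy => ?_, fun y => by rw [hv', hF]⟩
  rw [hv', hF ⟨y, hy⟩]
  exact Submodule.algebraMap_mem _

theorem IsSpecial.hasCyclicDiscriminant [IsDomain R] [IsPrincipalIdealRing R] {Q : QuadraticForm k V}
    {L : Submodule R V} (h : IsSpecial Q L) :
    HasCyclicDiscriminant (integralForm Q h.integral) := by
  have := h.isLattice
  obtain ⟨⟨g, hg⟩⟩ := h.cyclic
  obtain ⟨v₀, rfl⟩ := Submodule.Quotient.mk_surjective _ g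
  refine ⟨LinearMap.BilinForm.dualSubmoduleToDual Q.polarBilin L v₀, fun f => ?_⟩
  obtain ⟨v, hv, hvf⟩ := exists_dual_forall_eq h.regular f
  have hmem : (Submodule.Quotient.mk ⟨v, hv⟩ :
      dual Q L ⧸ L.submoduleOf (dual Q L)) ∈ R ∙ Submodule.Quotient.mk v₀ :=
    hg ▸ Submodule.mem_top
  obtain ⟨r, hr⟩ := Submodule.mem_span_singleton.1 hmem
  rw [← Submodule.Quotient.mk_smul, eq_comm, Submodule.Quotient.eq] at hr
  refine ⟨r, ⟨v - r • (v₀ : V), hr⟩, fun y => IsFractionRing.injective R k ?_⟩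
  have h1 : algebraMap R k (LinearMap.BilinForm.dualSubmoduleToDual Q.polarBilin L v₀ y) =
      Q.polarBilin (v₀ : V) y := LinearMap.BilinForm.dualSubmoduleParing_spec _ _ _
  rw [map_add, map_mul, h1, algebraMap_polarBilin_integralForm, ← hvf]
  rw [map_sub, LinearMap.sub_apply, ← algebraMap_smul k r (v₀ : V), map_smul, LinearMap.smul_apply, smul_eq_mul]
  ring

/-- A linear isomorphism of lattices preserving the values of the quadratic forms extends to an
isometry of the quadratic spaces. -/
theorem isometric_of_linearEquiv [IsDomain R] [IsPrincipalIdealRing R] {Q : QuadraticForm k V}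
    {L : Submodule R V} {P : QuadraticForm k W} {M : Submodule R W} [L.IsLattice k] [M.IsLattice k]
    (φ : L ≃ₗ[R] M) (hφ : ∀ x, P (φ x : W) = Q x) : Isometric Q L P M := by
  let b := Module.finBasis R L
  let bV := b.extendOfIsLattice k
  let bW := (b.map φ).extendOfIsLattice k
  let σ : V ≃ₗ[k] W := bV.equiv bW (Equiv.refl _)
  have hσ (x : L) : σ x = φ x := by
    have : σ.toLinearMap.restrictScalars R ∘ₗ L.subtype = M.subtype ∘ₗ φ.toLinearMap := by
      refine b.ext fun i => ?_
      have := bV.equiv_apply i bW (Equiv.refl _)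
      rw [Module.Basis.extendOfIsLattice_apply, Equiv.refl_apply,
        Module.Basis.extendOfIsLattice_apply, Module.Basis.map_apply] at this
      exact this
    exact LinearMap.congr_fun this x
  -- Clearing denominators moves any vector into L, where the values of the forms are known to
  -- agree.
  have hex (v : V) : ∃ (r : R) (x : L), r ≠ 0 ∧ algebraMap R k r • v = x := by
    obtain ⟨r, hr⟩ := IsLocalization.exist_integer_multiples (nonZeroDivisors R) Finset.univ
      fun i => bV.repr v i
    choose c hc using fun i => hr i (Finset.mem_univ i)
    refine ⟨r, ∑ i, c i • b i, nonZeroDivisors.coe_ne_zero r, ?_⟩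
    conv_lhs => rw [← bV.sum_repr v]
    rw [Finset.smul_sum, AddSubmonoidClass.coe_finsetSum]
    refine Finset.sum_congr rfl fun i _ => ?_
    rw [Submodule.coe_smul, ← algebraMap_smul k (c i), hc, Module.Basis.extendOfIsLattice_apply,
      smul_smul, Algebra.smul_def]
  refine ⟨{ toLinearEquiv := σ, map_app' := fun v => ?_ }, fun v => ⟨fun hv => ?_, fun hv => ?_⟩⟩
  · obtain ⟨r, x, hr, hx⟩ := hex v
    have hr' : algebraMap R k r ≠ 0 := by simpa using hr
    have h1 := hφ x
    rw [← hσ, ← hx, map_smul, QuadraticMap.map_smul, QuadraticMap.map_smul, smul_eq_mul,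
      smul_eq_mul] at h1
    exact mul_left_cancel₀ (mul_ne_zero hr' hr') h1
  · have h1 : σ (φ.symm ⟨σ v, hv⟩ : L) = σ v := by rw [hσ, LinearEquiv.apply_symm_apply]
    rw [← σ.injective h1]
    exact Subtype.property _
  · change σ v ∈ M
    rw [hσ ⟨v, hv⟩]
    exact Subtype.property _

end Lattice

/-! ### Comparing determinants -/

section Determinant

theorem exists_det_toMatrix_eq {R M ι κ : Type*} [CommRing R] [Nontrivial R] [AddCommGroup M]
    [Module R M] [Fintype ι] [DecidableEq ι] [Fintype κ] [DecidableEq κ] (b : Module.Basis ι R M)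
    (b' : Module.Basis κ R M) (B : LinearMap.BilinForm R M) :
    ∃ u : Rˣ, (LinearMap.BilinForm.toMatrix b B).det =
      u ^ 2 * (LinearMap.BilinForm.toMatrix b' B).det := by
  let e := b'.indexEquiv b
  obtain ⟨u, hu⟩ := (b'.reindex e).isUnit_det b
  rw [Module.Basis.det_apply] at hu
  refine ⟨u, ?_⟩
  have h1 : (LinearMap.BilinForm.toMatrix (b'.reindex e) B).det =
      (LinearMap.BilinForm.toMatrix b' B).det := by
    rw [← Matrix.det_submatrix_equiv_self e.symm (LinearMap.BilinForm.toMatrix b' B)]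
    congr 1
    ext i j
    simp [LinearMap.BilinForm.toMatrix_apply]
  rw [← LinearMap.BilinForm.toMatrix_mul_basis_toMatrix (b'.reindex e) b, Matrix.det_mul,
    Matrix.det_mul, Matrix.det_transpose, h1, ← hu]
  ring

variable {R k V : Type*} [CommRing R] [IsDomain R] [Field k] [Algebra R k] [IsFractionRing R k]
variable [AddCommGroup V] [Module R V] [Module k V] [IsScalarTower R k V]

/-- A change of basis multiplies the determinant by a unit square u², and the sign (-1)^n of the
model cancels that of `signedDet`. The common factor 2 is then cancelled in k; u² is kept beside a,
into which it is absorbed by rescaling the last coordinate. -/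
theorem HasDet.exists_mul_eq {Q : QuadraticForm k V} {L : Submodule R V} (hL : IsIntegral Q L)
    (h2 : (2 : k) ≠ 0) {N : R} (hN : HasDet Q L (2 * algebraMap R k N)) {n : ℕ} (hn : 1 ≤ n)
    {ε a : R} (hq : (integralForm Q hL).Equivalent (modelForm n ε a)) :
    ∃ u : Rˣ, a * u ^ 2 * (1 - 4 * ε) = N := by
  obtain ⟨m, b, hb⟩ := hN
  obtain ⟨φ⟩ := hq
  let b' := (modelBasis R n).map φ.toLinearEquiv.symm
  have hm : m = 2 * n + 1 := by
    have := Fintype.card_congr (b.indexEquiv b')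
    simp at this
    omega
  obtain ⟨u, hu⟩ := exists_det_toMatrix_eq b b' (integralForm Q hL).polarBilin
  have h1 : LinearMap.BilinForm.toMatrix b' (integralForm Q hL).polarBilin =
      LinearMap.BilinForm.toMatrix (modelBasis R n) (modelForm n ε a).polarBilin := by
    ext i j
    rw [LinearMap.BilinForm.toMatrix_apply, LinearMap.BilinForm.toMatrix_apply,
      ← polarBilin_isometryEquiv φ]
    have h (i) : φ (b' i) = modelBasis R n i := by
      rw [Module.Basis.map_apply]
      exact φ.toLinearEquiv.apply_symm_apply _
    rw [h, h]
  have h3 : (Matrix.of fun i j => Q.polarBilin (b i : V) (b j : V)).det =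
      algebraMap R k (LinearMap.BilinForm.toMatrix b (integralForm Q hL).polarBilin).det := by
    rw [RingHom.map_det]
    congr 1
    ext i j
    simp only [Matrix.of_apply, RingHom.mapMatrix_apply, Matrix.map_apply,
      LinearMap.BilinForm.toMatrix_apply, algebraMap_polarBilin_integralForm]
  rw [signedDet, h3, hu, h1, det_toMatrix_modelForm hn, hm] at hb
  have hdiv : (2 * n + 1) / 2 = n := by omega
  refine ⟨u, IsFractionRing.injective R k (mul_left_cancel₀ h2 ?_)⟩
  rw [← hb, hdiv]
  have hsign : ((-1 : k) ^ n) * (-1) ^ n = 1 := by rw [← mul_pow]; simp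
  simp only [map_mul, map_pow, map_sub, map_neg, map_one, map_ofNat]
  linear_combination -2 * algebraMap R k a * algebraMap R k u ^ 2 *
    (1 - 4 * algebraMap R k ε) * hsign

end Determinant

/-! ### Model lattices: duals, specialness, Eichler invariants -/

section ModelLattice

variable (R k : Type*) [CommRing R] [Field k] [Algebra R k]

/-- The inclusion of the standard free module of rank `2 n + 1` into the standard space. -/
def modelInclusion (n : ℕ) : ((Fin n → R × R) × R) →ₗ[R] ((Fin n → k × k) × k) :=
  (((Algebra.linearMap R k).prodMap (Algebra.linearMap R k)).compLeft (Fin n)).prodMap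
    (Algebra.linearMap R k)

/-- The standard lattice of rank `2 n + 1`. -/
def modelLattice (n : ℕ) : Submodule R ((Fin n → k × k) × k) :=
  (modelInclusion R k n).range

variable {R k} {n : ℕ}

theorem modelInclusion_apply (x : (Fin n → R × R) × R) :
    modelInclusion R k n x =
      (fun i => (algebraMap R k (x.1 i).1, algebraMap R k (x.1 i).2), algebraMap R k x.2) :=
  rfl

theorem modelInclusion_modelBasis (i : (Fin 2 × Fin n) ⊕ Unit) :
    modelInclusion R k n (modelBasis R n i) = modelBasis k n i := by
  rcases i with ⟨j, i⟩ | i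
  · rw [modelBasis_inl, modelBasis_inl, modelInclusion_apply]
    refine Prod.ext (funext fun l => ?_) (map_zero _)
    by_cases hl : l = i
    · subst hl
      fin_cases j <;> simp
    · simp [hl]
  · rw [modelBasis_inr, modelBasis_inr, modelInclusion_apply]
    simp
    rfl

theorem modelForm_modelInclusion (ε a : R) (x : (Fin n → R × R) × R) :
    modelForm n (algebraMap R k ε) (algebraMap R k a) (modelInclusion R k n x) =
      algebraMap R k (modelForm n ε a x) := by
  simp only [modelForm_apply, modelInclusion_apply, binaryForm_apply, map_add, map_mul, map_sum,
    map_pow, apply_ite (algebraMap R k), map_zero]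

theorem isIntegral_modelLattice (ε a : R) :
    IsIntegral (modelForm n (algebraMap R k ε) (algebraMap R k a)) (modelLattice R k n) := by
  rintro _ ⟨x, rfl⟩
  exact ⟨_, (modelForm_modelInclusion ε a x).symm⟩

instance isLattice_modelLattice : (modelLattice R k n).IsLattice k where
  fg := Module.Finite.iff_fg.1 (Module.Finite.range _)
  span_eq_top := by
    rw [eq_top_iff, ← (modelBasis k n).span_eq]
    refine Submodule.span_mono ?_
    rintro _ ⟨i, rfl⟩
    exact ⟨modelBasis R n i, modelInclusion_modelBasis i⟩

theorem nondegenerate_modelForm (hn : 1 ≤ n) (h2 : (2 : k) ≠ 0) {ε a : k}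
    (ha : a * (1 - 4 * ε) ≠ 0) : (modelForm n ε a).polarBilin.Nondegenerate := by
  refine LinearMap.BilinForm.nondegenerate_of_det_ne_zero _ (modelBasis k n) ?_
  rw [det_toMatrix_modelForm hn]
  exact mul_ne_zero (pow_ne_zero _ (by simp)) (mul_ne_zero h2 ha)

theorem finrank_modelSpace : Module.finrank k ((Fin n → k × k) × k) = 2 * n + 1 := by
  rw [Module.finrank_eq_card_basis (modelBasis k n)]
  simp

theorem mem_dual_iff {V : Type*} [AddCommGroup V] [Module R V] [Module k V] [IsScalarTower R k V]
    {Q : QuadraticForm k V} {L : Submodule R V} {x : V} :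
    x ∈ dual Q L ↔ ∀ y ∈ L, ∃ r : R, algebraMap R k r = Q.polarBilin x y := by
  simp only [dual, LinearMap.BilinForm.mem_dualSubmodule, Submodule.mem_one]

/-- The planes have unit discriminant and are self-dual, so passing to the dual enlarges only the
last coordinate, to multiples of 1/(2a). -/
theorem mem_dual_modelLattice {ε a : R} (hε : IsUnit (1 - 4 * ε)) {x : (Fin n → k × k) × k} :
    x ∈ dual (modelForm n (algebraMap R k ε) (algebraMap R k a)) (modelLattice R k n) ↔
      ∃ (m : Fin n → R × R) (t : R), x.1 = (modelInclusion R k n (m, 0)).1 ∧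
        2 * algebraMap R k a * x.2 = algebraMap R k t := by
  rw [mem_dual_iff]
  constructor
  · intro h
    have hi (i : Fin n) : ∃ m : R × R, x.1 i = (algebraMap R k m.1, algebraMap R k m.2) := by
      obtain ⟨r, hr⟩ := h _ ⟨modelBasis R n (.inl (0, i)), rfl⟩
      obtain ⟨s, hs⟩ := h _ ⟨modelBasis R n (.inl (1, i)), rfl⟩
      rw [modelInclusion_modelBasis, modelForm_polarBilin, Finset.sum_eq_single i
        (fun l _ hl => by simp [hl]) (by simp)] at hr hs
      obtain ⟨c, hc, hcu⟩ : ∃ c : R, algebraMap R k c =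
          (if (i : ℕ) + 1 = n then algebraMap R k ε else 0) ∧ IsUnit (1 - 4 * c) := by
        by_cases h : (i : ℕ) + 1 = n
        · exact ⟨ε, by simp [h], hε⟩
        · exact ⟨0, by simp [h], by simp⟩
      rw [← hc] at hr hs
      simp at hr hs
      obtain ⟨d, hd⟩ := hcu
      have hd' : algebraMap R k (1 - 4 * c) * algebraMap R k ↑d⁻¹ = 1 := by
        rw [← hd, ← map_mul, Units.mul_inv, map_one]
      refine ⟨(↑d⁻¹ * (s - 2 * c * r), ↑d⁻¹ * (r - 2 * s)), Prod.ext ?_ ?_⟩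
      · simp only [map_mul, map_sub, map_one, map_ofNat] at hd' ⊢
        linear_combination (-(x.1 i).1) * hd' -
          algebraMap R k ↑d⁻¹ * (hs - 2 * algebraMap R k c * hr)
      · simp only [map_mul, map_sub, map_one, map_ofNat] at hd' ⊢
        linear_combination (-(x.1 i).2) * hd' - algebraMap R k ↑d⁻¹ * (hr - 2 * hs)
    choose m hm using hi
    obtain ⟨t, ht⟩ := h _ ⟨modelBasis R n (.inr ()), rfl⟩
    rw [modelInclusion_modelBasis, modelForm_polarBilin] at ht
    simp at ht
    exact ⟨m, t, funext hm, ht.symm⟩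
  · rintro ⟨m, t, hm, ht⟩ _ ⟨y, rfl⟩
    refine ⟨(modelForm n ε 0).polarBilin (m, 0) y + t * y.2, ?_⟩
    rw [modelForm_polarBilin, modelForm_polarBilin, ht, hm, modelInclusion_apply,
      modelInclusion_apply]
    simp [apply_ite (algebraMap R k), map_ofNat]

variable [IsFractionRing R k]

theorem modelInclusion_injective : Function.Injective (modelInclusion R k n) := by
  have hinj := IsFractionRing.injective R k
  intro x y h
  rw [modelInclusion_apply, modelInclusion_apply, Prod.mk.injEq] at h
  refine Prod.ext (funext fun i => ?_) (hinj h.2)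
  have := congrFun h.1 i
  rw [Prod.mk.injEq] at this
  exact Prod.ext (hinj this.1) (hinj this.2)

variable (k n) in
/-- The standard free module of rank `2 n + 1` is the standard lattice. -/
noncomputable def modelLatticeEquiv : ((Fin n → R × R) × R) ≃ₗ[R] modelLattice R k n :=
  LinearEquiv.ofInjective (modelInclusion R k n) modelInclusion_injective

theorem coe_modelLatticeEquiv (x : (Fin n → R × R) × R) :
    (modelLatticeEquiv k n x : (Fin n → k × k) × k) = modelInclusion R k n x :=
  rfl

theorem hasDet_modelLattice (hn : 1 ≤ n) (ε a : R) :
    HasDet (modelForm n (algebraMap R k ε) (algebraMap R k a)) (modelLattice R k n)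
      (2 * algebraMap R k (a * (1 - 4 * ε))) := by
  let e : (Fin 2 × Fin n) ⊕ Unit ≃ Fin (2 * n + 1) := Fintype.equivFinOfCardEq (by simp)
  let b := ((modelBasis R n).map (modelLatticeEquiv k n)).reindex e
  have hb (i) : ((b i : modelLattice R k n) : (Fin n → k × k) × k) = modelBasis k n (e.symm i) := by
    rw [Module.Basis.reindex_apply, Module.Basis.map_apply, ← modelInclusion_modelBasis (R := R),
      coe_modelLatticeEquiv]
  refine ⟨2 * n + 1, b, ?_⟩
  have h1 := det_toMatrix_modelForm hn (algebraMap R k ε) (algebraMap R k a)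
  rw [← Matrix.det_submatrix_equiv_self e.symm] at h1
  have h2 : (Matrix.of fun i j => (modelForm n (algebraMap R k ε) (algebraMap R k a)).polarBilin
      (b i : (Fin n → k × k) × k) (b j : (Fin n → k × k) × k)) =
      (LinearMap.BilinForm.toMatrix (modelBasis k n)
        (modelForm n (algebraMap R k ε) (algebraMap R k a)).polarBilin).submatrix e.symm e.symm := by
    ext i j
    rw [Matrix.of_apply, Matrix.submatrix_apply, LinearMap.BilinForm.toMatrix_apply, hb, hb]
  have hdiv : (2 * n + 1) / 2 = n := by omega
  rw [signedDet, h2, h1, hdiv, ← mul_assoc, ← mul_pow]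
  simp [map_ofNat]

theorem isSpecial_modelLattice (hn : 1 ≤ n) (h2 : (2 : k) ≠ 0) {ε a : R}
    (ha : a ≠ 0) (hε : IsUnit (1 - 4 * ε)) :
    IsSpecial (modelForm n (algebraMap R k ε) (algebraMap R k a)) (modelLattice R k n) where
  regular := by
    refine nondegenerate_modelForm hn h2 (mul_ne_zero ?_ ?_)
    · simpa using ha
    · have := (hε.map (algebraMap R k)).ne_zero
      simpa [map_ofNat] using this
  isLattice := inferInstance
  integral := isIntegral_modelLattice ε a
  odd_rank := by rw [finrank_modelSpace]; simp
  cyclic := by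
    have ha' : algebraMap R k a ≠ 0 := by simpa using ha
    have hz : ((0, (2 * algebraMap R k a)⁻¹) : (Fin n → k × k) × k) ∈
        dual (modelForm n (algebraMap R k ε) (algebraMap R k a)) (modelLattice R k n) := by
      refine (mem_dual_modelLattice hε).2 ⟨0, 1, ?_, ?_⟩
      · ext <;> simp [modelInclusion_apply]
      · rw [map_one]; exact mul_inv_cancel₀ (mul_ne_zero h2 ha')
    refine ⟨⟨Submodule.Quotient.mk ⟨_, hz⟩, ?_⟩⟩
    rw [eq_comm, eq_top_iff]
    rintro y -
    obtain ⟨⟨x, hx⟩, rfl⟩ := Submodule.Quotient.mk_surjective _ y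
    obtain ⟨m, t, hm, ht⟩ := (mem_dual_modelLattice hε).1 hx
    refine Submodule.mem_span_singleton.2 ⟨t, ?_⟩
    rw [← Submodule.Quotient.mk_smul, eq_comm, Submodule.Quotient.eq]
    refine ⟨(m, 0), Prod.ext ?_ ?_⟩
    · simp [hm]
    · simp [modelInclusion_apply, Algebra.smul_def, ← ht]
      field_simp
      simp

/-- The generator 1/(2N) of the last coordinate of the dual has value N/(4N²) = 1/(4N). -/
theorem eichlerInvariant_modelLattice_zero (h2 : (2 : k) ≠ 0) {N : R} (hN : N ≠ 0) :
    eichlerInvariant (modelForm n (algebraMap R k 0) (algebraMap R k N)) (modelLattice R k n) N =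
      1 := by
  have hN' : algebraMap R k N ≠ 0 := by simpa using hN
  refine if_pos ⟨(0, (2 * algebraMap R k N)⁻¹), ?_, ?_⟩
  · refine (mem_dual_modelLattice (by simp)).2 ⟨0, 1, ?_, ?_⟩
    · ext <;> simp [modelInclusion_apply]
    · rw [map_one]; exact mul_inv_cancel₀ (mul_ne_zero h2 hN')
  · rw [modelForm_apply]
    simp
    field_simp
    norm_num

/-- With t/(2a) the last coordinate and μ the value on the planes, the defining equation reads 4w +
(1 - 4c)t² = 1 with w = a(1 - 4c)μ a nonunit. It forces t to be a unit of the form 2s + 1 and w =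
ct² - s² - s. Then w is t² times the value of X² + X + c at -s/t, a unit: a contradiction. -/
theorem eichlerInvariant_modelLattice_of_forall_isUnit [IsLocalRing R] [IsIntegrallyClosed R]
    (h2 : (2 : k) ≠ 0) {c a : R} (hc : ∀ t : R, IsUnit (t ^ 2 + t + c)) (hc' : IsUnit (1 - 4 * c))
    (ha : a ≠ 0) (hau : ¬ IsUnit a) :
    eichlerInvariant (modelForm n (algebraMap R k c) (algebraMap R k a)) (modelLattice R k n)
      (a * (1 - 4 * c)) = -1 := by
  refine if_neg ?_
  rintro ⟨x, hx, h⟩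
  have ha' : algebraMap R k a ≠ 0 := by simpa using ha
  obtain ⟨m, t, hm, ht⟩ := (mem_dual_modelLattice hc').1 hx
  obtain ⟨μ, hμ⟩ : ∃ μ : R, modelForm n (algebraMap R k c) (algebraMap R k a) x =
      algebraMap R k μ + algebraMap R k a * x.2 ^ 2 := by
    refine ⟨modelForm n c 0 (m, 0), ?_⟩
    rw [← modelForm_modelInclusion, modelForm_apply, modelForm_apply, hm]
    simp [modelInclusion_apply]
  have hsum : 4 * (a * (1 - 4 * c)) * μ + (1 - 4 * c) * t ^ 2 = 1 := by
    refine IsFractionRing.injective R k ?_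
    rw [hμ] at h
    simp only [map_add, map_mul, map_sub, map_one, map_ofNat, map_pow, ← ht] at h ⊢
    linear_combination h
  set w := a * (1 - 4 * c) * μ with hw
  have hwu : ¬ IsUnit w := fun h => hau (isUnit_of_mul_isUnit_left (isUnit_of_mul_isUnit_left h))
  have hsumk := congrArg (algebraMap R k) hsum
  simp only [map_add, map_mul, map_sub, map_one, map_ofNat, map_pow] at hsumk
  have hs : ((algebraMap R k t - 1) / 2) ^ 2 + (algebraMap R k t - 1) / 2 -
      algebraMap R k (c * t ^ 2 - w) = 0 := by
    simp only [hw, map_mul, map_sub, map_pow, map_one, map_ofNat]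
    field_simp
    linear_combination hsumk
  -- Although 2 may be a nonunit, (t - 1)/2 is a root of a monic polynomial over R, hence lies in R.
  obtain ⟨s, hs'⟩ : ∃ s : R, algebraMap R k s = (algebraMap R k t - 1) / 2 := by
    rw [← IsIntegrallyClosed.isIntegral_iff]
    refine ⟨Polynomial.X ^ 2 + Polynomial.X - Polynomial.C (c * t ^ 2 - w), by monicity!, ?_⟩
    simpa using hs
  rw [← hs'] at hs
  have hst : t = 2 * s + 1 := by
    refine IsFractionRing.injective R k ?_
    rw [map_add, map_mul, hs', map_one, map_ofNat]
    field_simp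
    ring
  have hsw : s ^ 2 + s - (c * t ^ 2 - w) = 0 := by
    refine IsFractionRing.injective R k ?_
    simpa using hs
  obtain ⟨t', ht'⟩ : IsUnit t := by
    have h4 : IsUnit (1 - 4 * w) := by
      by_contra h
      have := Ideal.add_mem _ ((mem_maximalIdeal _).2 h)
        (Ideal.mul_mem_left _ 4 ((mem_maximalIdeal _).2 hwu))
      rw [sub_add_cancel] at this
      exact (mem_maximalIdeal _).1 this isUnit_one
    have : 1 - 4 * w = t * (t * (1 - 4 * c)) := by linear_combination -hsum + 4 * hw
    rw [this] at h4
    exact isUnit_of_mul_isUnit_left h4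
  refine hwu ?_
  have ht1 : t * ↑t'⁻¹ = 1 := by rw [← ht', Units.mul_inv]
  have : w = t' ^ 2 * ((-s * ↑t'⁻¹) ^ 2 + -s * ↑t'⁻¹ + c) := by
    rw [ht']
    linear_combination hsw - s ^ 2 * (t * ↑t'⁻¹ + 1) * ht1 + s * t * ht1 + s * hst
  rw [this]
  exact (t'.isUnit.pow 2).mul (hc _)

end ModelLattice

/-! ### Classification of special lattices by determinant and Eichler invariant -/

/-- A special lattice is isometric to a model lattice determined by its determinant. -/
theorem IsSpecial.exists_isometric_modelLattice {R k V : Type*} [CommRing R] [IsDomain R]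
    [IsPrincipalIdealRing R] [HenselianLocalRing R] [Finite (ResidueField R)] [Field k]
    [Algebra R k] [IsFractionRing R k] [AddCommGroup V] [Module R V] [Module k V]
    [IsScalarTower R k V] {Q : QuadraticForm k V} {L : Submodule R V} (h : IsSpecial Q L)
    (h2 : (2 : k) ≠ 0) {n : ℕ} (hn : 1 ≤ n) (hV : Module.finrank k V = 2 * n + 1) {N : R}
    (hN : HasDet Q L (2 * algebraMap R k N)) {c : R} (hc : ∀ t : R, IsUnit (t ^ 2 + t + c)) :
    ∃ ε a : R, a * (1 - 4 * ε) = N ∧ (ε = 0 ∨ ε = c ∧ ¬ IsUnit a) ∧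
      Isometric Q L (modelForm n (algebraMap R k ε) (algebraMap R k a)) (modelLattice R k n) := by
  have := h.isLattice
  have hL : Module.finrank R L = 2 * n + 1 := by
    rw [← hV]
    exact congrArg Cardinal.toNat (Submodule.IsLattice.rank' k L)
  obtain ⟨ε, a, hε, hq⟩ := h.hasCyclicDiscriminant.equivalent_modelForm hn hL hc
  obtain ⟨u, hu⟩ := hN.exists_mul_eq h.integral h2 hn hq
  obtain ⟨φ⟩ := hq.trans (modelForm_equivalent_mul_sq n ε a u)
  refine ⟨ε, a * u ^ 2, hu,
    hε.imp_right fun h => ⟨h.1, fun h' => h.2 (isUnit_of_mul_isUnit_left h')⟩,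
    isometric_of_linearEquiv (φ.toLinearEquiv.trans (modelLatticeEquiv k n)) fun x => ?_⟩
  rw [LinearEquiv.trans_apply, coe_modelLatticeEquiv, modelForm_modelInclusion,
    ← algebraMap_integralForm Q h.integral]
  exact congrArg _ (φ.map_app x)

/-- The model lattices are special, and their Eichler invariant is `1` exactly when `ε = 0`. -/
theorem isSpecialOfType_modelLattice {R k : Type*} [CommRing R] [IsDomain R]
    [IsPrincipalIdealRing R] [HenselianLocalRing R] [Field k] [Algebra R k] [IsFractionRing R k]
    (h2 : (2 : k) ≠ 0) {n : ℕ} (hn : 1 ≤ n) {N : R} (hN : N ≠ 0) {c : R}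
    (hc : ∀ t : R, IsUnit (t ^ 2 + t + c)) {ε a : R} (ha : a * (1 - 4 * ε) = N)
    (hε : ε = 0 ∨ ε = c ∧ ¬ IsUnit a) :
    ∃ e : ℤˣ, (e = 1 ↔ ε = 0) ∧
      IsSpecialOfType (modelForm n (algebraMap R k ε) (algebraMap R k a)) (modelLattice R k n)
        (2 * n + 1) N e := by
  subst ha
  have ha : a ≠ 0 := left_ne_zero_of_mul hN
  have hc' := isUnit_one_sub_four_mul hc
  have hεu : IsUnit (1 - 4 * ε) := by
    rcases hε with rfl | ⟨rfl, -⟩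
    · simp
    · exact hc'
  refine ⟨_, ?_, isSpecial_modelLattice hn h2 ha hεu, finrank_modelSpace,
    hasDet_modelLattice hn ε a, rfl⟩
  rcases hε with rfl | ⟨rfl, hau⟩
  · simp only [mul_zero, sub_zero, mul_one, eichlerInvariant_modelLattice_zero h2 ha]
  · rw [eichlerInvariant_modelLattice_of_forall_isUnit h2 hc hc' ha hau]
    have hε0 : ε ≠ 0 := fun h => not_isUnit_zero (M₀ := R) (by simpa [h] using hc 0)
    simp [hε0]

theorem henselianLocalRing_integer (k : Type*) [Field k] [ValuativeRel k] [TopologicalSpace k]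
    [IsNonarchimedeanLocalField k] : HenselianLocalRing 𝒪[k] := by
  let := IsTopologicalAddGroup.rightUniformSpace k
  have := isUniformAddGroup_of_addCommGroup (G := k)
  have : HenselianRing 𝒪[k] 𝓂[k] := inferInstance
  exact { is_henselian := fun f hf a h1 h2 => this.is_henselian f hf a h1 (by
    rw [← residue_ne_zero_iff_isUnit] at h2
    exact IsUnit.mk0 _ h2) }

theorem exists_forall_isUnit_sq_add_self_add {R : Type*} [CommRing R] [HenselianLocalRing R]
    [Finite (ResidueField R)] : ∃ c : R, ∀ t : R, IsUnit (t ^ 2 + t + c) := by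
  obtain ⟨c, hc⟩ := exists_forall_sq_add_self_add_ne_zero (F := ResidueField R)
  obtain ⟨c, rfl⟩ := residue_surjective c
  refine ⟨c, fun t => (residue_ne_zero_iff_isUnit _).1 ?_⟩
  simpa using hc (residue R t)

/-- The Eichler invariant is preserved by isometry and detects whether ε = 0 on the models, so it
decides which of the two values ε takes. -/
theorem IsSpecialOfType.isometric_modelLattice {R k V : Type*} [CommRing R] [IsDomain R]
    [IsPrincipalIdealRing R] [HenselianLocalRing R] [Finite (ResidueField R)] [Field k]
    [Algebra R k] [IsFractionRing R k] [AddCommGroup V] [Module R V] [Module k V]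
    [IsScalarTower R k V] {Q : QuadraticForm k V} {L : Submodule R V} {n : ℕ} {N : R} {e : ℤˣ}
    (h : IsSpecialOfType Q L (2 * n + 1) N e) (h2 : (2 : k) ≠ 0) (hn : 1 ≤ n) (hN : N ≠ 0)
    {c : R} (hc : ∀ t : R, IsUnit (t ^ 2 + t + c)) :
    ∃ ε a : R, a * (1 - 4 * ε) = N ∧ ε = (if e = 1 then 0 else c) ∧
      Isometric Q L (modelForm n (algebraMap R k ε) (algebraMap R k a)) (modelLattice R k n) := by
  obtain ⟨hspec, hrank, hdet, rfl⟩ := h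
  obtain ⟨ε, a, ha, hε, hiso⟩ := hspec.exists_isometric_modelLattice h2 hn hrank hdet hc
  obtain ⟨e, he, -, -, -, rfl⟩ := isSpecialOfType_modelLattice (k := k) h2 hn hN hc ha hε
  refine ⟨ε, a, ha, ?_, hiso⟩
  rw [hiso.eichlerInvariant_eq]
  split_ifs with h
  · exact he.1 h
  · exact (hε.resolve_left fun h' => h (he.2 h')).1

end QuadraticLattice

theorem mainTheorem9 {k : Type u} [Field k] [ValuativeRel k] [TopologicalSpace k]
    [IsNonarchimedeanLocalField k] (hk : (2 : k) ≠ 0)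
    (n : ℕ) (hn : 1 ≤ n) (N : 𝒪[k]) (hN : N ≠ 0) (e : ℤˣ) (he : IsUnit N → e = 1) :
    (∃ (V : Type u) (_ : AddCommGroup V) (_ : Module k V)
      (Q : QuadraticForm k V) (L : Submodule 𝒪[k] V),
      QuadraticLattice.IsSpecialOfType Q L (2 * n + 1) N e) ∧
    (∀ (V : Type v) (W : Type w) [AddCommGroup V] [Module k V] [AddCommGroup W] [Module k W]
      (Q : QuadraticForm k V) (L : Submodule 𝒪[k] V)
      (P : QuadraticForm k W) (M : Submodule 𝒪[k] W),
      QuadraticLattice.IsSpecialOfType Q L (2 * n + 1) N e →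
      QuadraticLattice.IsSpecialOfType P M (2 * n + 1) N e →
      QuadraticLattice.Isometric Q L P M) := by
  have := QuadraticLattice.henselianLocalRing_integer k
  obtain ⟨c, hc⟩ := QuadraticLattice.exists_forall_isUnit_sq_add_self_add (R := 𝒪[k])
  have hcu := QuadraticLattice.isUnit_one_sub_four_mul hc
  constructor
  · obtain ⟨ε, a, ha, hε, heε⟩ : ∃ ε a : 𝒪[k], a * (1 - 4 * ε) = N ∧
        (ε = 0 ∨ ε = c ∧ ¬ IsUnit a) ∧ (e = 1 ↔ ε = 0) := by
      by_cases h : e = 1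
      · exact ⟨0, N, by simp, .inl rfl, by simp [h]⟩
      · obtain ⟨d, hd⟩ := hcu
        have hc0 : c ≠ 0 := fun h => not_isUnit_zero (M₀ := 𝒪[k]) (by simpa [h] using hc 0)
        -- For e = -1 the line must have coefficient N/(1 - 4c). It is a nonunit because N is, by
        -- the hypothesis on e.
        refine ⟨c, N * ↑d⁻¹, by rw [← hd]; simp, .inr ⟨rfl, fun h' => h (he ?_)⟩, by simp [h, hc0]⟩
        exact isUnit_of_mul_isUnit_left h'
    obtain ⟨e', he', hspec⟩ :=
      QuadraticLattice.isSpecialOfType_modelLattice (k := k) hk hn hN hc ha hε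
    have hee : e = e' := by
      have := heε.trans he'.symm
      rcases Int.units_eq_one_or e with rfl | rfl <;> rcases Int.units_eq_one_or e' with rfl | rfl
      all_goals first | rfl | simp at this
    rw [hee]
    exact ⟨_, _, _, _, _, hspec⟩
  · intro V W _ _ _ _ Q L P M hQ hP
    obtain ⟨ε, a, ha, rfl, hiso⟩ := hQ.isometric_modelLattice hk hn hN hc
    obtain ⟨ε, a', ha', rfl, hiso'⟩ := hP.isometric_modelLattice hk hn hN hc
    -- Both lattices have the same ε, so cancelling 1 - 4ε from the two expressions for N identifies
    -- their models.
    have hu : (1 - 4 * (if e = 1 then 0 else c)) ≠ 0 := right_ne_zero_of_mul (ha ▸ hN)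
    obtain rfl := mul_right_cancel₀ hu (ha.trans ha'.symm)
    exact hiso.trans hiso'.symm
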